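/- Let $N=2n+1$ be odd, $r$ an integer with $N\ge r+1$, $T>0$, and let $g\in L_1(\mathbb R)$ be a real-valued point spread function with Fourier transform $\widehat g(f)=\int e^{-2i\pi ft}g(t)\,dt$. Put $\Omega=\frac1T\{-n,\dots,n\}$ and $J_N=[-\frac N{2T},\frac N{2T}]$, and assume $\widehat g(f)\neq0$ for all $f\in\Omega$. Let $G=\mathrm{diag}([\widehat g(f)]_{f\in\Omega})$, and for $\tau\in\mathbb R^r$ let $V_\tau=[e^{-2i\pi f\tau_j}]_{f\in\Omega,\,j\in[r]}\in\mathbb C^{N\times r}$. Let $$E_g=\int_{J_N}|\widehat g(f)|^2df,\qquad \rho_g=E_g^{-1}\,\mathrm{TV}\big(|\widehat g|^2\mathbb 1_{J_N}\big),$$ where $\mathrm{TV}$ is the total variation over $\mathbb R$ of the function (the jumps at the ends of $J_N$ included). For true locations $\tau^\star\in\mathbb R^r$ let $|x|_T=\min_{p\in\mathbb Z}|x+pT|$ and $\Delta=\min_{j\ne j'}|\tau^\star_j-\tau^\star_{j'}|_T$ ($\Delta=\infty$ if $r=1$). Let $\Pi_1=[I_{N-1}\,|\,0]$, $\Pi_2=[0\,|\,I_{N-1}]$,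 $G_i=\Pi_iG\Pi_i^\top$, and $$\varrho_g=\max_{m\in[N-1]}\frac{|(G_2)_{m,m}|}{|(G_1)_{m,m}|}.$$ Let $U\in\mathbb C^{N\times r}$ have orthonormal columns that span the column space of $GV_{\tau^\star}$, and let $\widehat U\in\mathbb C^{N\times r}$ have orthonormal columns. Let $\mathrm{dist}(\widehat U,U)=\|\widehat U\widehat U^{\mathsf H}-UU^{\mathsf H}\|$ (spectral norm), which is the sine of the largest principal angle between the column spaces. Let $\widehat\tau\in\mathbb R^r$ be the ESPRIT estimate $\widehat\tau_k=-\frac T{2\pi}\arg\lambda_k$, where $\lambda_1,\dots,\lambda_r$ are the eigenvalues, with multiplicity, of $(\Pi_1\widehat U)^\dagger G_1G_2^{-1}\Pi_2\widehat U$ and $\dagger$ is the Moore–Penrose pseudo-inverse. Let $\mathrm{md}(\widehat\tau;\tau^\star)=\min_{\pi\in\mathfrak S_r}\max_{k\in[r]}|\tau^\star_k-\widehat\tau_{\pi(k)}|_T$. For every $r$ and every $\theta<1$ there is a constant $C>0$, depending only on $r$ and $\theta$, such that the following holds for all such data. Suppose that $\frac12\rho_g\Delta^{-1}\le\theta$,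 that the amplitude matrix $A\in\mathbb C^{r\times L}$ has full row rank, and that $$\mathrm{dist}(\widehat U,U)<\frac1{2\sqrt2}\sqrt{1-\frac{\|G\|^2r}{TE_g(1-\frac12\rho_g\Delta^{-1})}}.$$ Then $$\mathrm{md}(\widehat\tau;\tau^\star)\le C\,T\varrho_g\Big(1-\frac{\|G\|^2r}{TE_g(1-\frac12\rho_g\Delta^{-1})}\Big)^{-1}\mathrm{dist}(\widehat U,U).$$ -/

import Mathlib

open scoped Matrix.Norms.L2Operator
open scoped FourierTransform ENNReal

namespace PsfEsprit

/-! ### Moore-Penrose pseudo-inverse -/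

/-- `P` satisfies the four Penrose equations for `A`. -/
structure IsMoorePenrose {m k : ℕ} (A : Matrix (Fin m) (Fin k) ℂ)
    (P : Matrix (Fin k) (Fin m) ℂ) : Prop where
  mul_mul_self : A * P * A = A
  self_mul_mul : P * A * P = P
  isHermitian_left : (A * P).IsHermitian
  isHermitian_right : (P * A).IsHermitian

open scoped ComplexOrder in
theorem exists_isMoorePenrose {m k : ℕ} (A : Matrix (Fin m) (Fin k) ℂ) :
    ∃ P, IsMoorePenrose A P := by
  set B : Matrix (Fin k) (Fin k) ℂ := A.conjTranspose * A with hB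
  have hBs : IsSelfAdjoint B := Matrix.isHermitian_conjTranspose_mul_self A
  set Q : Matrix (Fin k) (Fin k) ℂ := cfc (fun x : ℝ => x⁻¹) B with hQ
  have hQs : IsSelfAdjoint Q := cfc_predicate _ _
  have hQh : Q.conjTranspose = Q := hQs
  have hfin : (spectrum ℝ B).Finite := Set.toFinite _
  have hc : ∀ f : ℝ → ℝ, ContinuousOn f (spectrum ℝ B) := fun f => hfin.continuousOn f
  have hid : cfc (fun x : ℝ => x) B = B := cfc_id' ℝ B
  have hQB : Q * B = cfc (fun x : ℝ => x⁻¹ * x) B := by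
    rw [cfc_mul (fun x : ℝ => x⁻¹) (fun x => x) B (hc _) (hc _), hid]
  have hBQ : B * Q = cfc (fun x : ℝ => x⁻¹ * x) B := by
    have : (fun x : ℝ => x⁻¹ * x) = fun x => x * x⁻¹ := by
      funext x; ring
    rw [this, cfc_mul (fun x : ℝ => x) (fun x => x⁻¹) B (hc _) (hc _), hid]
  have hBQB : B * (Q * B) = B := by
    conv_rhs => rw [← hid]
    rw [hQB]
    nth_rewrite 1 [← hid]
    rw [← cfc_mul (fun x : ℝ => x) (fun x => x⁻¹ * x) B (hc _) (hc _)]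
    congr 1
    funext x
    by_cases hx : x = 0 <;> simp [hx]
  have hQBQ : Q * B * Q = Q := by
    rw [hQB, hQ, ← cfc_mul (fun x : ℝ => x⁻¹ * x) (fun x => x⁻¹) B (hc _) (hc _)]
    congr 1
    funext x
    by_cases hx : x = 0 <;> simp [hx]
  refine ⟨Q * A.conjTranspose, ?_, ?_, ?_, ?_⟩
  · have h0 : A.conjTranspose * A * (Q * B - 1) = 0 := by
      rw [← hB, mul_sub, hBQB, mul_one, sub_self]
    have h1 := (Matrix.conjTranspose_mul_self_mul_eq_zero A (Q * B - 1)).1 h0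
    rw [Matrix.mul_sub, Matrix.mul_one, sub_eq_zero] at h1
    calc A * (Q * A.conjTranspose) * A = A * (Q * B) := by
          rw [hB]; simp only [Matrix.mul_assoc]
      _ = A := h1
  · calc Q * A.conjTranspose * A * (Q * A.conjTranspose)
        = Q * B * Q * A.conjTranspose := by rw [hB]; simp only [Matrix.mul_assoc]
      _ = Q * A.conjTranspose := by rw [hQBQ]
  · unfold Matrix.IsHermitian
    simp only [Matrix.conjTranspose_mul, Matrix.conjTranspose_conjTranspose, hQh,
      Matrix.mul_assoc]
  · have h : Q * A.conjTranspose * A = cfc (fun x : ℝ => x⁻¹ * x) B := by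
      rw [Matrix.mul_assoc, ← hB, hQB]
    rw [h]
    exact cfc_predicate (fun x : ℝ => x⁻¹ * x) B

/-- The Moore-Penrose pseudo-inverse `A†`. -/
noncomputable def pinv {m k : ℕ} (A : Matrix (Fin m) (Fin k) ℂ) : Matrix (Fin k) (Fin m) ℂ :=
  Classical.choose (exists_isMoorePenrose A)

theorem pinv_spec {m k : ℕ} (A : Matrix (Fin m) (Fin k) ℂ) : IsMoorePenrose A (pinv A) :=
  Classical.choose_spec (exists_isMoorePenrose A)

/-! ### The point spread function and its Fourier metrics

The number of measurements is `N = 2 * n + 1`. -/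

/-- The continuous Fourier transform `ĝ(f) = ∫ exp (-2 π i f t) g(t) dt`. -/
noncomputable def ghat (g : ℝ → ℝ) (f : ℝ) : ℂ := 𝓕 (fun t : ℝ => (g t : ℂ)) f

/-- The band `J_N = [-N / (2T), N / (2T)]`. -/
def band (n : ℕ) (T : ℝ) : Set ℝ :=
  Set.Icc (-((2 * n + 1 : ℝ) / (2 * T))) ((2 * n + 1 : ℝ) / (2 * T))

/-- The sampling frequencies, `Ω = (1/T) {-n, ..., n}`. -/
noncomputable def freq (n : ℕ) (T : ℝ) (m : Fin (2 * n + 1)) : ℝ := ((m : ℝ) - n) / T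

/-- `E_g`, the energy of `g` in the band. -/
noncomputable def bandEnergy (n : ℕ) (T : ℝ) (g : ℝ → ℝ) : ℝ :=
  ∫ f in band n T, ‖ghat g f‖ ^ 2

/-- `ρ_g`, the total variation over the real line of the power spectral density truncated to the
band (the jumps at the two ends of the band count), divided by `E_g`. -/
noncomputable def flatness (n : ℕ) (T : ℝ) (g : ℝ → ℝ) : ℝ≥0∞ :=
  eVariationOn ((band n T).indicator fun f => ‖ghat g f‖ ^ 2) Set.univ /
    ENNReal.ofReal (bandEnergy n T g)

/-- The distance of two reals modulo `T`. -/
noncomputable def torusDist (T x y : ℝ) : ℝ := ⨅ p : ℤ, |x - y + p * T|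

/-- The minimal separation `Δ` of the locations; it is `∞` if there is only one location. -/
noncomputable def minSep {r : ℕ} (T : ℝ) (τ : Fin r → ℝ) : ℝ≥0∞ :=
  ⨅ (j : Fin r) (k : Fin r) (_ : j ≠ k), ENNReal.ofReal (torusDist T (τ j) (τ k))

/-- The matching distance of two families of locations modulo `T`. -/
noncomputable def matchDist {r : ℕ} (T : ℝ) (τ' τ : Fin r → ℝ) : ℝ :=
  ⨅ π : Equiv.Perm (Fin r), ⨆ k : Fin r, torusDist T (τ k) (τ' (π k))

/-! ### The measurement matrices -/

/-- `G = diag (ĝ(f))_{f ∈ Ω}`. -/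
noncomputable def matG (n : ℕ) (T : ℝ) (g : ℝ → ℝ) :
    Matrix (Fin (2 * n + 1)) (Fin (2 * n + 1)) ℂ :=
  Matrix.diagonal fun m => ghat g (freq n T m)

/-- The Vandermonde matrix `V_τ`, with entries `exp (-2 π i f τ_j)`, `f ∈ Ω`. -/
noncomputable def matV {r : ℕ} (n : ℕ) (T : ℝ) (τ : Fin r → ℝ) :
    Matrix (Fin (2 * n + 1)) (Fin r) ℂ :=
  Matrix.of fun m j =>
    Complex.exp (-2 * (Real.pi : ℂ) * Complex.I * (freq n T m : ℂ) * (τ j : ℂ))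

/-- `Π₁ = [I | 0]`, which drops the last row. -/
def proj1 (n : ℕ) : Matrix (Fin (2 * n)) (Fin (2 * n + 1)) ℂ :=
  Matrix.of fun i j => if j = i.castSucc then 1 else 0

/-- `Π₂ = [0 | I]`, which drops the first row. -/
def proj2 (n : ℕ) : Matrix (Fin (2 * n)) (Fin (2 * n + 1)) ℂ :=
  Matrix.of fun i j => if j = i.succ then 1 else 0

/-- `G₁ = Π₁ G Π₁ᵀ`. -/
noncomputable def matG1 (n : ℕ) (T : ℝ) (g : ℝ → ℝ) : Matrix (Fin (2 * n)) (Fin (2 * n)) ℂ :=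
  proj1 n * matG n T g * (proj1 n).transpose

/-- `G₂ = Π₂ G Π₂ᵀ`. -/
noncomputable def matG2 (n : ℕ) (T : ℝ) (g : ℝ → ℝ) : Matrix (Fin (2 * n)) (Fin (2 * n)) ℂ :=
  proj2 n * matG n T g * (proj2 n).transpose

/-- `ϱ_g`, the largest ratio of the moduli of consecutive diagonal entries of `G`. -/
noncomputable def amplification (n : ℕ) (T : ℝ) (g : ℝ → ℝ) : ℝ :=
  ⨆ m : Fin (2 * n), ‖matG2 n T g m m‖ / ‖matG1 n T g m m‖

/-! ### Subspaces and ESPRIT -/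

/-- The columns of `U` are orthonormal. -/
def OrthonormalCols {N r : ℕ} (U : Matrix (Fin N) (Fin r) ℂ) : Prop :=
  U.conjTranspose * U = 1

/-- `dist(Û, U) = ‖Û Ûᴴ - U Uᴴ‖` in the spectral norm. -/
noncomputable def subspaceDist {N r : ℕ} (U' U : Matrix (Fin N) (Fin r) ℂ) : ℝ :=
  ‖U' * U'.conjTranspose - U * U.conjTranspose‖

/-- The ESPRIT matrix `Û₁† G₁ G₂⁻¹ Û₂`, where `Û₁ = Π₁ Û` and `Û₂ = Π₂ Û`. -/
noncomputable def espritMatrix {r : ℕ} (n : ℕ) (T : ℝ) (g : ℝ → ℝ)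
    (U' : Matrix (Fin (2 * n + 1)) (Fin r) ℂ) : Matrix (Fin r) (Fin r) ℂ :=
  pinv (proj1 n * U') * matG1 n T g * (matG2 n T g)⁻¹ * (proj2 n * U')

/-- `τ'` is an output of ESPRIT: `τ'_k = -(T / 2π) arg λ_k`, where `λ_1, ..., λ_r` lists the
eigenvalues of the ESPRIT matrix with algebraic multiplicity, in any order. -/
def IsEspritEstimate {r : ℕ} (n : ℕ) (T : ℝ) (g : ℝ → ℝ)
    (U' : Matrix (Fin (2 * n + 1)) (Fin r) ℂ) (τ' : Fin r → ℝ) : Prop :=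
  ∃ μ : Fin r → ℂ,
    (espritMatrix n T g U').charpoly = ∏ k, (Polynomial.X - Polynomial.C (μ k)) ∧
    ∀ k, τ' k = -(T / (2 * Real.pi)) * Complex.arg (μ k)

/-- The quantity `½ ρ_g Δ⁻¹`. -/
noncomputable def sepRatio {r : ℕ} (n : ℕ) (T : ℝ) (g : ℝ → ℝ) (τ : Fin r → ℝ) : ℝ≥0∞ :=
  flatness n T g / (2 * minSep T τ)

/-- The factor `1 - ‖G‖² r / (T E_g (1 - ½ ρ_g Δ⁻¹))`. -/
noncomputable def espritFactor {r : ℕ} (n : ℕ) (T : ℝ) (g : ℝ → ℝ) (τ : Fin r → ℝ) : ℝ :=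
  1 - ‖matG n T g‖ ^ 2 * r / (T * bandEnergy n T g * (1 - (sepRatio n T g τ).toReal))

end PsfEsprit

namespace PsfEsprit

/-! ### The Montgomery-Vaughan form of Hilbert's inequality -/

/-! Put `W = G V`, `K = G₁ G₂⁻¹`, `z_k = exp(-2πi τ_k / T)` and `D = diag z`. Consecutive rows of
`V` differ by the factor `D`, so `K Π₂ W = Π₁ W D` (`shift_invariance`), and with exact data the
ESPRIT matrix is similar to `D`. The theorem is a quantitative perturbation of this fact, with no
loss in `N`. It has three ingredients.

Conditioning of `W`. For `r ≥ 2`, `‖W a‖²` lies within the factors `1 ± ½ ρ_g Δ⁻¹` of `T E_g ‖a‖²`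
(`frame_bounds`). This is a large sieve inequality with a weight of bounded variation. Summation by
parts turns the off-diagonal part of `‖W a‖²` into a combination of Hilbert forms with kernel `csc
π(x_j - x_k)`, whose coefficients are the increments of the weight. Each form is at most `1 / d`
times the energy by Montgomery-Vaughan (`TorusSeparated.hilbert_inequality`). Refining the grid
replaces the sum of samples of `|ĝ|²` by the integral `T E_g`. Hence `W` has condition number at
most `κ = √((1 + θ) / (1 - θ))`, and deleting one row of an orthonormal basis `U` leaves squared
singular values at least `F`, the factor in the theorem. For `r = 1` the evenness of `|ĝ|` gives at
least `1/2`.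

Perturbation. Write `Û = U R + E` with `R = Uᴴ Û` invertible and `‖E‖ ≤ dist`. The ESPRIT matrix is
then similar to `D + B` with `‖B‖` of order `ϱ_g F^(-1/2) dist` (`exists_diagonal_add_charpoly_eq`).

Matching. `D` is normal, so Bauer-Fike puts each eigenvalue of `D + tB` within `‖B‖` of some `z_j`.
A connectedness argument in `t` makes this a bijective matching, at the price of the factor `2r`
(`exists_perm_norm_sub_le`). Taking arguments is Lipschitz on the torus (`torusDist_arg_le`). -/

/-- The Taylor bounds `sin y ≥ y - y³/6` and `cos y ≤ 1 - y²/2 + y⁴/24` suffice: inserted into the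
two sides, both give exactly `3y² - y⁴ + y⁶/12`. -/
theorem sq_mul_one_add_two_cos_le {y : ℝ} (h0 : 0 ≤ y) (h1 : y ≤ Real.pi / 2) :
    y ^ 2 * (1 + 2 * Real.cos y) ≤ 3 * Real.sin y ^ 2 := by
  have hy2 : y ≤ 2 := by linarith [Real.pi_le_four]
  have hs := Real.sin_ge_sub_cube h0
  have hs2 := Real.sin_ge_sub_cube (x := y / 2) (by linarith)
  have hy4 : 0 ≤ 4 - y ^ 2 := by nlinarith
  have hp : 0 ≤ y - y ^ 3 / 6 := by nlinarith [mul_nonneg h0 hy4]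
  have hp2 : 0 ≤ y / 2 - (y / 2) ^ 3 / 6 := by nlinarith [mul_nonneg h0 hy4]
  have hc : Real.cos y = 1 - 2 * Real.sin (y / 2) ^ 2 := by
    have h2 := Real.cos_two_mul (y / 2)
    have h3 := Real.sin_sq_add_cos_sq (y / 2)
    rw [mul_div_cancel₀ y two_ne_zero] at h2
    linarith
  have h4 : (y / 2 - (y / 2) ^ 3 / 6) ^ 2 ≤ Real.sin (y / 2) ^ 2 := pow_le_pow_left₀ hp2 hs2 2
  have h5 : (y - y ^ 3 / 6) ^ 2 ≤ Real.sin y ^ 2 := pow_le_pow_left₀ hp hs 2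
  have h6 : Real.cos y ≤ 1 - y ^ 2 / 2 + y ^ 4 / 24 := by
    rw [hc]
    nlinarith [sq_nonneg (y ^ 3)]
  nlinarith [mul_le_mul_of_nonneg_left h6 (sq_nonneg y)]

theorem csc_sq_add_le (t : ℝ) (ht : |t| ≤ 1 / 2) (ht0 : t ≠ 0) :
    (Real.sin (Real.pi * t))⁻¹ ^ 2 +
      2 * |(Real.sin (Real.pi * t))⁻¹ * (Real.cos (Real.pi * t) / Real.sin (Real.pi * t))| ≤
      3 / Real.pi ^ 2 * (1 / t ^ 2) := by
  have hpi := Real.pi_pos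
  have key : ∀ u : ℝ, 0 < u → u ≤ 1 / 2 →
      (Real.sin (Real.pi * u))⁻¹ ^ 2 +
      2 * |(Real.sin (Real.pi * u))⁻¹ * (Real.cos (Real.pi * u) / Real.sin (Real.pi * u))| ≤
      3 / Real.pi ^ 2 * (1 / u ^ 2) := by
    intro u hu hu2
    have h1 : Real.pi * u ≤ Real.pi / 2 := by nlinarith
    have h0 : 0 < Real.pi * u := by positivity
    have hs : 0 < Real.sin (Real.pi * u) := Real.sin_pos_of_pos_of_lt_pi h0 (by linarith)
    have hc : 0 ≤ Real.cos (Real.pi * u) :=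
      Real.cos_nonneg_of_mem_Icc ⟨by linarith, h1⟩
    rw [abs_of_nonneg (by positivity)]
    have hm := sq_mul_one_add_two_cos_le h0.le h1
    have e1 : (Real.sin (Real.pi * u))⁻¹ ^ 2 +
      2 * ((Real.sin (Real.pi * u))⁻¹ * (Real.cos (Real.pi * u) / Real.sin (Real.pi * u)))
      = (1 + 2 * Real.cos (Real.pi * u)) / Real.sin (Real.pi * u) ^ 2 := by
      field_simp
    have e2 : 3 / Real.pi ^ 2 * (1 / u ^ 2) = 3 / (Real.pi * u) ^ 2 := by
      field_simp
    rw [e1, e2, div_le_div_iff₀ (by positivity) (by positivity)]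
    linarith
  rcases lt_or_gt_of_ne ht0 with h | h
  · have := key (-t) (by linarith) (by rwa [abs_of_neg h] at ht)
    simpa [Real.sin_neg, Real.cos_neg, abs_mul, abs_div, abs_inv] using this
  · exact key t h (by rwa [abs_of_pos h] at ht)

/-- By separation the integers `⌊t i / d⌋` are distinct and positive, so the sum is dominated by
`ζ(2) / d²`. -/
theorem sum_one_div_sq_le_of_pos {ι : Type*} (s : Finset ι) (t : ι → ℝ) {d : ℝ} (hd : 0 < d)
    (h0 : ∀ i ∈ s, d ≤ t i) (hsep : ∀ i ∈ s, ∀ j ∈ s, i ≠ j → d ≤ |t i - t j|) :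
    ∑ i ∈ s, 1 / t i ^ 2 ≤ Real.pi ^ 2 / 6 / d ^ 2 := by
  classical
  let f : ι → ℕ := fun i => ⌊t i / d⌋₊
  have hpos : ∀ i ∈ s, 0 < t i := fun i hi => hd.trans_le (h0 i hi)
  have hinj : Set.InjOn f s := by
    intro i hi j hj hij
    by_contra hne
    have h1 := hsep i hi j hj hne
    have a1 := Nat.floor_le (div_nonneg (hpos i hi).le hd.le)
    have a2 := Nat.lt_floor_add_one (t i / d)
    have b1 := Nat.floor_le (div_nonneg (hpos j hj).le hd.le)
    have b2 := Nat.lt_floor_add_one (t j / d)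
    have hij' : (⌊t i / d⌋₊ : ℝ) = ⌊t j / d⌋₊ := by exact_mod_cast hij
    have h2 : |t i / d - t j / d| < 1 := by
      rw [abs_lt]; constructor <;> linarith
    rw [← sub_div, abs_div, abs_of_pos hd, div_lt_one hd] at h2
    linarith
  have hone : ∀ i ∈ s, 1 ≤ f i := fun i hi => Nat.le_floor (by
    rw [Nat.cast_one, le_div_iff₀ hd, one_mul]; exact h0 i hi)
  calc ∑ i ∈ s, 1 / t i ^ 2 ≤ ∑ i ∈ s, (1 / (f i : ℝ) ^ 2) / d ^ 2 := by
        refine Finset.sum_le_sum fun i hi => ?_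
        have h1 : (1 : ℝ) ≤ f i := by exact_mod_cast hone i hi
        have h2 : (f i : ℝ) * d ≤ t i := by
          rw [← le_div_iff₀ hd]
          exact Nat.floor_le (div_nonneg (hpos i hi).le hd.le)
        rw [div_div, ← mul_pow]
        exact one_div_le_one_div_of_le (by positivity) (pow_le_pow_left₀ (by positivity) h2 2)
    _ = (∑ m ∈ s.image f, 1 / (m : ℝ) ^ 2) / d ^ 2 := by
        rw [Finset.sum_image hinj, Finset.sum_div]
    _ ≤ Real.pi ^ 2 / 6 / d ^ 2 := by
        gcongr
        exact sum_le_hasSum _ (fun _ _ => by positivity) hasSum_zeta_two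

theorem sum_one_div_sq_le {ι : Type*} (s : Finset ι) (t : ι → ℝ) {d : ℝ} (hd : 0 < d)
    (h0 : ∀ i ∈ s, d ≤ |t i|) (hsep : ∀ i ∈ s, ∀ j ∈ s, i ≠ j → d ≤ |t i - t j|) :
    ∑ i ∈ s, 1 / t i ^ 2 ≤ Real.pi ^ 2 / 3 / d ^ 2 := by
  classical
  rw [← Finset.sum_filter_add_sum_filter_not s (fun i => 0 < t i)]
  have h1 := sum_one_div_sq_le_of_pos (s.filter fun i => 0 < t i) t hd
    (fun i hi => by
      obtain ⟨hi, hp⟩ := Finset.mem_filter.1 hi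
      simpa [abs_of_pos hp] using h0 i hi)
    (fun i hi j hj => hsep i (Finset.mem_filter.1 hi).1 j (Finset.mem_filter.1 hj).1)
  have h2 := sum_one_div_sq_le_of_pos (s.filter fun i => ¬ 0 < t i) (fun i => - t i) hd
    (fun i hi => by
      obtain ⟨hi, hp⟩ := Finset.mem_filter.1 hi
      simpa [abs_of_nonpos (not_lt.1 hp)] using h0 i hi)
    (fun i hi j hj hij => by
      have := hsep j (Finset.mem_filter.1 hj).1 i (Finset.mem_filter.1 hi).1 hij.symm
      rwa [show -t i - -t j = t j - t i by ring])
  simp only [neg_sq] at h2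
  calc _ ≤ Real.pi ^ 2 / 6 / d ^ 2 + Real.pi ^ 2 / 6 / d ^ 2 := add_le_add h1 h2
    _ = _ := by ring

/-- The points `x i` are `d`-separated modulo `1`. -/
def TorusSeparated {ι : Type*} (x : ι → ℝ) (d : ℝ) : Prop :=
  ∀ i j, i ≠ j → ∀ p : ℤ, d ≤ |x i - x j + p|

/-- The reciprocal of `sin π (x i - x j)`, zero on the diagonal. -/
noncomputable def csc {ι : Type*} (x : ι → ℝ) (i j : ι) : ℝ :=
  (Real.sin (Real.pi * (x i - x j)))⁻¹

/-- The cotangent of `π (x i - x j)`, zero on the diagonal. -/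
noncomputable def cot {ι : Type*} (x : ι → ℝ) (i j : ι) : ℝ :=
  Real.cos (Real.pi * (x i - x j)) / Real.sin (Real.pi * (x i - x j))

theorem csc_self {ι : Type*} (x : ι → ℝ) (i : ι) : csc x i i = 0 := by simp [csc]

theorem cot_self {ι : Type*} (x : ι → ℝ) (i : ι) : cot x i i = 0 := by simp [cot]

theorem csc_swap {ι : Type*} (x : ι → ℝ) (i j : ι) : csc x i j = - csc x j i := by
  rw [csc, csc, ← inv_neg, ← Real.sin_neg]; congr 2; ring

theorem cot_swap {ι : Type*} (x : ι → ℝ) (i j : ι) : cot x i j = - cot x j i := by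
  rw [cot, cot, ← div_neg, ← Real.sin_neg, ← Real.cos_neg]
  congr 2 <;> ring

theorem csc_sq_add_two_abs_le {ι : Type*} (x : ι → ℝ) (i j : ι)
    (h : x i - x j - round (x i - x j) ≠ 0) :
    csc x i j ^ 2 + 2 * |csc x i j * cot x i j| ≤
      3 / Real.pi ^ 2 * (1 / (x i - x j - round (x i - x j)) ^ 2) := by
  have h1 := csc_sq_add_le _ (abs_sub_round (x i - x j)) h
  refine le_trans (le_of_eq ?_) h1
  rw [csc, cot, mul_sub Real.pi (x i - x j), mul_comm Real.pi (round _ : ℝ), Real.sin_sub_int_mul_pi,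
    Real.cos_sub_int_mul_pi]
  have hz : |(-1 : ℝ) ^ round (x i - x j)| = 1 := by simp [abs_zpow]
  rcases eq_or_eq_neg_of_abs_eq hz with h | h <;> simp [h, abs_mul, abs_div, abs_inv]

/-- The differences `x j - x k`, reduced to `[-1/2, 1/2]`, stay `d`-separated from each other and
from `0`. The constant `3/π²` of `csc_sq_add_le` cancels against `π²/3 = 2 ζ(2)`, which is why the
final bound is `1 / d` with constant one. -/
theorem TorusSeparated.sum_csc_sq_le {ι : Type*} [Fintype ι] {x : ι → ℝ} {d : ℝ}
    (hd : 0 < d) (hx : TorusSeparated x d) (k : ι) :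
    ∑ j, (csc x j k ^ 2 + 2 * |csc x j k * cot x j k|) ≤ 1 / d ^ 2 := by
  classical
  have hne : ∀ j, j ≠ k → d ≤ |x j - x k - round (x j - x k)| := by
    intro j hj
    have := hx j k hj (-round (x j - x k))
    push_cast at this
    rwa [← sub_eq_add_neg] at this
  calc ∑ j, (csc x j k ^ 2 + 2 * |csc x j k * cot x j k|)
      = ∑ j ∈ Finset.univ.erase k, (csc x j k ^ 2 + 2 * |csc x j k * cot x j k|) := by
        rw [← Finset.add_sum_erase _ _ (Finset.mem_univ k)]
        simp [csc_self]
    _ ≤ ∑ j ∈ Finset.univ.erase k,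
          3 / Real.pi ^ 2 * (1 / (x j - x k - round (x j - x k)) ^ 2) := by
        refine Finset.sum_le_sum fun j hj => csc_sq_add_two_abs_le x j k ?_
        have := hne j (Finset.ne_of_mem_erase hj)
        intro h0
        rw [h0, abs_zero] at this
        linarith
    _ ≤ 3 / Real.pi ^ 2 * (Real.pi ^ 2 / 3 / d ^ 2) := by
        rw [← Finset.mul_sum]
        gcongr
        refine sum_one_div_sq_le _ _ hd (fun j hj => hne j (Finset.ne_of_mem_erase hj)) ?_
        intro i _ j _ hij
        have := hx i j hij (round (x j - x k) - round (x i - x k))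
        push_cast at this
        convert this using 2
        ring
    _ = 1 / d ^ 2 := by
        have := Real.pi_pos
        field_simp

theorem TorusSeparated.sin_ne_zero {ι : Type*} {x : ι → ℝ} {d : ℝ}
    (hd : 0 < d) (hx : TorusSeparated x d) {j k : ι} (hjk : j ≠ k) :
    Real.sin (Real.pi * (x j - x k)) ≠ 0 := by
  intro h
  obtain ⟨n, hn⟩ := Real.sin_eq_zero_iff.1 h
  have h1 := hx j k hjk (-n)
  have h2 : x j - x k = n := by
    have := Real.pi_pos
    apply mul_left_cancel₀ this.ne'
    linarith
  rw [h2] at h1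
  simp at h1
  linarith

/-- For distinct indices this is the subtraction formula for `sin((x j - x k) - (x j - x l))`. The
three corrections account for coinciding indices, where the kernels are zero by convention. -/
theorem TorusSeparated.csc_mul_csc {ι : Type*} [DecidableEq ι] {x : ι → ℝ} {d : ℝ}
    (hd : 0 < d) (hx : TorusSeparated x d) (j k l : ι) :
    csc x j k * csc x j l = csc x l k * (cot x j l - cot x j k) +
      (if j = k then csc x l k * cot x l k else 0) +
      (if j = l then csc x l k * cot x l k else 0) +
      (if k = l then csc x j k ^ 2 else 0) := by
  rcases eq_or_ne k l with rfl | hkl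
  · simp [csc_self, sq]
  rcases eq_or_ne j k with rfl | hjk
  · simp [csc_self, cot_self, hkl]
    rw [cot_swap x j l]; ring
  rcases eq_or_ne j l with rfl | hjl
  · simp [csc_self, cot_self, hkl, hjk]
  simp only [hkl, hjk, hjl, if_false, add_zero]
  have h1 := hx.sin_ne_zero hd hjk
  have h2 := hx.sin_ne_zero hd hjl
  have h3 := hx.sin_ne_zero hd hkl.symm
  simp only [csc, cot]
  have h4 : Real.sin (Real.pi * (x l - x k)) =
      Real.sin (Real.pi * (x j - x k)) * Real.cos (Real.pi * (x j - x l)) -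
      Real.cos (Real.pi * (x j - x k)) * Real.sin (Real.pi * (x j - x l)) := by
    rw [← Real.sin_sub]; congr 1; ring
  have h5 : (Real.sin (Real.pi * (x j - x k)))⁻¹ * (Real.sin (Real.pi * (x j - x l)))⁻¹ =
      (Real.sin (Real.pi * (x l - x k)))⁻¹ * (Real.sin (Real.pi * (x l - x k)) *
        ((Real.sin (Real.pi * (x j - x k)))⁻¹ * (Real.sin (Real.pi * (x j - x l)))⁻¹)) := by
    rw [inv_mul_cancel_left₀ h3]
  rw [h5]
  congr 1
  rw [h4]
  field_simp

theorem TorusSeparated.sum_csc_mul_csc {ι : Type*} [Fintype ι] [DecidableEq ι] {x : ι → ℝ} {d : ℝ}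
    (hd : 0 < d) (hx : TorusSeparated x d) (k l : ι) :
    ∑ j, csc x j k * csc x j l = csc x l k * (∑ j, cot x j l - ∑ j, cot x j k) +
      2 * (csc x l k * cot x l k) + (if k = l then ∑ j, csc x j k ^ 2 else 0) := by
  rw [Finset.sum_congr rfl fun j _ => hx.csc_mul_csc hd j k l]
  simp only [Finset.sum_add_distrib, ← Finset.mul_sum, Finset.sum_sub_distrib,
    Finset.sum_ite_eq', Finset.mem_univ, if_true]
  rcases eq_or_ne k l with rfl | hkl
  · simp [csc_self]
  · simp [hkl]; ring

open Matrix in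
theorem l2_opNorm_le_of_eigenvalues {ι : Type*} [Fintype ι] [DecidableEq ι] {A : Matrix ι ι ℂ}
    (hA : A.IsHermitian) {c : ℝ} (hc : 0 ≤ c)
    (h : ∀ (lam : ℝ) (v : ι → ℂ), v ≠ 0 → A *ᵥ v = (lam : ℂ) • v → |lam| ≤ c) : ‖A‖ ≤ c := by
  have h1 : ∀ i, |hA.eigenvalues i| ≤ c := by
    intro i
    refine h _ _ ?_ (by simpa using hA.mulVec_eigenvectorBasis i)
    intro h0
    have := hA.eigenvectorBasis.orthonormal.ne_zero i
    exact this (by ext k; exact congrFun h0 k)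
  have h2 : ‖(diagonal (RCLike.ofReal ∘ hA.eigenvalues) : Matrix ι ι ℂ)‖ ≤ c := by
    rw [l2_opNorm_diagonal]
    refine (pi_norm_le_iff_of_nonneg hc).2 fun i => ?_
    simpa using h1 i
  rw [hA.spectral_theorem, Unitary.conjStarAlgAut_apply]
  rw [CStarRing.norm_mul_mem_unitary _ (by simp), CStarRing.norm_coe_unitary_mul]
  exact h2

open Matrix ComplexConjugate in
/-- The squared eigenvalues of the matrix `i csc π (x j - x k)`, expanded. -/
theorem TorusSeparated.eigenvalue_sq_mul {ι : Type*} [Fintype ι] {x : ι → ℝ} {d : ℝ}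
    (hd : 0 < d) (hx : TorusSeparated x d) (lam : ℝ) (v : ι → ℂ)
    (hv : ∀ j, ∑ k, (csc x j k : ℂ) * v k = -Complex.I * lam * v j) :
    (lam : ℂ) ^ 2 * ∑ j, v j * conj (v j) =
      ∑ k, ∑ l, 2 * ((csc x l k * cot x l k : ℝ) : ℂ) * (v k * conj (v l)) +
      ∑ k, ((∑ j, csc x j k ^ 2 : ℝ) : ℂ) * (v k * conj (v k)) := by
  classical
  have hv' : ∀ j, ∑ k, (csc x j k : ℂ) * conj (v k) = Complex.I * lam * conj (v j) := by
    intro j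
    have := congrArg conj (hv j)
    simpa using this
  have h1 : (lam : ℂ) ^ 2 * ∑ j, v j * conj (v j) =
      ∑ j, (∑ k, (csc x j k : ℂ) * v k) * (∑ l, (csc x j l : ℂ) * conj (v l)) := by
    rw [Finset.mul_sum]
    refine Finset.sum_congr rfl fun j _ => ?_
    rw [hv, hv']
    linear_combination ((lam : ℂ) ^ 2 * v j * conj (v j)) * Complex.I_sq
  have h2 : ∑ j, (∑ k, (csc x j k : ℂ) * v k) * (∑ l, (csc x j l : ℂ) * conj (v l)) =
      ∑ k, ∑ l, ((∑ j, csc x j k * csc x j l : ℝ) : ℂ) * (v k * conj (v l)) := by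
    simp only [Finset.sum_mul_sum]
    rw [Finset.sum_comm]
    refine Finset.sum_congr rfl fun k _ => ?_
    rw [Finset.sum_comm]
    refine Finset.sum_congr rfl fun l _ => ?_
    push_cast
    rw [Finset.sum_mul]
    exact Finset.sum_congr rfl fun j _ => by ring
  set c : ι → ℝ := fun k => ∑ j, cot x j k with hc
  -- The point of working with an eigenvector: the cotangent sums `c l` and `c k` both contribute
  -- `-iλ ∑ c_k |v_k|²` by the eigenvalue equation, and cancel.
  have h3 : ∑ k, ∑ l, ((csc x l k * (c l - c k) : ℝ) : ℂ) * (v k * conj (v l)) = 0 := by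
    have e1 : ∑ k, ∑ l, ((csc x l k : ℂ) * c l) * (v k * conj (v l)) =
        ∑ l, -Complex.I * lam * (c l * (v l * conj (v l))) := by
      rw [Finset.sum_comm]
      refine Finset.sum_congr rfl fun l _ => ?_
      calc _ = (∑ k, (csc x l k : ℂ) * v k) * (c l * conj (v l)) := by
            rw [Finset.sum_mul]; exact Finset.sum_congr rfl fun k _ => by ring
        _ = _ := by rw [hv]; ring
    have e2 : ∑ k, ∑ l, ((csc x l k : ℂ) * c k) * (v k * conj (v l)) =
        ∑ k, -Complex.I * lam * (c k * (v k * conj (v k))) := by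
      refine Finset.sum_congr rfl fun k _ => ?_
      calc _ = -(∑ l, (csc x k l : ℂ) * conj (v l)) * (c k * v k) := by
            rw [← Finset.sum_neg_distrib, Finset.sum_mul]
            refine Finset.sum_congr rfl fun l _ => ?_
            rw [csc_swap x l k]; push_cast; ring
        _ = _ := by rw [hv']; ring
    calc _ = ∑ k, ∑ l, ((csc x l k : ℂ) * c l) * (v k * conj (v l)) -
          ∑ k, ∑ l, ((csc x l k : ℂ) * c k) * (v k * conj (v l)) := by
            rw [← Finset.sum_sub_distrib]
            refine Finset.sum_congr rfl fun k _ => ?_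
            rw [← Finset.sum_sub_distrib]
            refine Finset.sum_congr rfl fun l _ => ?_
            push_cast; ring
      _ = 0 := by rw [e1, e2, sub_self]
  rw [h1, h2, ← zero_add (∑ k, ∑ l, 2 * ((csc x l k * cot x l k : ℝ) : ℂ) * _), ← h3,
    ← Finset.sum_add_distrib, ← Finset.sum_add_distrib]
  refine Finset.sum_congr rfl fun k _ => ?_
  have h4 : ((∑ j, csc x j k ^ 2 : ℝ) : ℂ) * (v k * conj (v k)) =
      ∑ l, (if k = l then ((∑ j, csc x j k ^ 2 : ℝ) : ℂ) else 0) * (v k * conj (v l)) := by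
    simp
  rw [h4, ← Finset.sum_add_distrib, ← Finset.sum_add_distrib]
  refine Finset.sum_congr rfl fun l _ => ?_
  rw [hx.sum_csc_mul_csc hd k l]
  simp only [hc]
  split_ifs <;> push_cast <;> ring

open Matrix ComplexConjugate in
-- Bounding `2 |v_k v_l|` by `|v_k|² + |v_l|²` in the expansion of `λ² ‖v‖²` collects, in front of
-- `|v_k|²`, exactly the column sum of `csc² + 2 |csc cot|`.
theorem TorusSeparated.abs_eigenvalue_le {ι : Type*} [Fintype ι] {x : ι → ℝ} {d : ℝ}
    (hd : 0 < d) (hx : TorusSeparated x d) (lam : ℝ) (v : ι → ℂ) (hv0 : v ≠ 0)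
    (hv : ∀ j, ∑ k, (csc x j k : ℂ) * v k = -Complex.I * lam * v j) : |lam| ≤ 1 / d := by
  have h := congrArg norm (hx.eigenvalue_sq_mul hd lam v hv)
  have hpos : 0 < ∑ j, ‖v j‖ ^ 2 := by
    obtain ⟨i, hi⟩ := Function.ne_iff.1 hv0
    have : 0 < ‖v i‖ := norm_pos_iff.2 hi
    exact Finset.sum_pos' (fun _ _ => by positivity) ⟨i, Finset.mem_univ i, by positivity⟩
  have e1 : ‖(lam : ℂ) ^ 2 * ∑ j, v j * conj (v j)‖ = lam ^ 2 * ∑ j, ‖v j‖ ^ 2 := by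
    have : ∑ j, v j * conj (v j) = ((∑ j, ‖v j‖ ^ 2 : ℝ) : ℂ) := by
      push_cast
      exact Finset.sum_congr rfl fun j _ => Complex.mul_conj' _
    rw [this, ← Complex.ofReal_pow, ← Complex.ofReal_mul, Complex.norm_real, Real.norm_eq_abs,
      abs_of_nonneg (by positivity)]
  have hsymm : ∀ k l, |csc x l k * cot x l k| = |csc x k l * cot x k l| := fun k l => by
    rw [csc_swap x l k, cot_swap x l k, neg_mul_neg]
  have e2 : ‖∑ k, ∑ l, 2 * ((csc x l k * cot x l k : ℝ) : ℂ) * (v k * conj (v l))‖ ≤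
      ∑ k, (∑ j, 2 * |csc x j k * cot x j k|) * ‖v k‖ ^ 2 := by
    calc _ ≤ ∑ k, ∑ l, |csc x l k * cot x l k| * (‖v k‖ ^ 2 + ‖v l‖ ^ 2) := by
          refine norm_sum_le_of_le _ fun k _ => norm_sum_le_of_le _ fun l _ => ?_
          rw [norm_mul, norm_mul, norm_mul, RCLike.norm_conj, Complex.norm_real, Real.norm_eq_abs,
            Complex.norm_ofNat]
          have := two_mul_le_add_sq ‖v k‖ ‖v l‖
          nlinarith [mul_le_mul_of_nonneg_left this (abs_nonneg (csc x l k * cot x l k))]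
      _ = ∑ k, ∑ l, |csc x l k * cot x l k| * ‖v k‖ ^ 2 +
          ∑ l, ∑ k, |csc x l k * cot x l k| * ‖v l‖ ^ 2 := by
          rw [Finset.sum_comm (f := fun l k => |csc x l k * cot x l k| * ‖v l‖ ^ 2)]
          simp only [← Finset.sum_add_distrib, mul_add]
      _ = _ := by
          rw [← Finset.sum_add_distrib]
          refine Finset.sum_congr rfl fun k _ => ?_
          rw [Finset.sum_mul, ← Finset.sum_add_distrib]
          refine Finset.sum_congr rfl fun l _ => ?_
          rw [hsymm k l]; ring
  have e3 : ‖∑ k, ((∑ j, csc x j k ^ 2 : ℝ) : ℂ) * (v k * conj (v k))‖ ≤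
      ∑ k, (∑ j, csc x j k ^ 2) * ‖v k‖ ^ 2 := by
    refine norm_sum_le_of_le _ fun k _ => ?_
    rw [norm_mul, norm_mul, RCLike.norm_conj, Complex.norm_real, Real.norm_eq_abs,
      abs_of_nonneg (by positivity), ← sq]
  have e4 : lam ^ 2 * ∑ j, ‖v j‖ ^ 2 ≤ (1 / d) ^ 2 * ∑ j, ‖v j‖ ^ 2 := by
    calc lam ^ 2 * ∑ j, ‖v j‖ ^ 2 ≤ ∑ k, (∑ j, 2 * |csc x j k * cot x j k|) * ‖v k‖ ^ 2 +
          ∑ k, (∑ j, csc x j k ^ 2) * ‖v k‖ ^ 2 := by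
          rw [← e1, h]
          exact (norm_add_le _ _).trans (add_le_add e2 e3)
      _ = ∑ k, (∑ j, (csc x j k ^ 2 + 2 * |csc x j k * cot x j k|)) * ‖v k‖ ^ 2 := by
          rw [← Finset.sum_add_distrib]
          refine Finset.sum_congr rfl fun k _ => ?_
          rw [Finset.sum_add_distrib]; ring
      _ ≤ ∑ k, (1 / d ^ 2) * ‖v k‖ ^ 2 := by
          gcongr with k
          exact hx.sum_csc_sq_le hd k
      _ = _ := by rw [Finset.mul_sum]; simp
  exact abs_le_of_sq_le_sq (le_of_mul_le_mul_right e4 hpos) (by positivity)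

open Matrix ComplexConjugate in
/-- The **Montgomery-Vaughan** inequality. -/
theorem TorusSeparated.hilbert_inequality {ι : Type*} [Fintype ι] {x : ι → ℝ} {d : ℝ}
    (hd : 0 < d) (hx : TorusSeparated x d) (a : ι → ℂ) :
    ‖∑ j, ∑ k, (csc x j k : ℂ) * (conj (a j) * a k)‖ ≤ 1 / d * ∑ j, ‖a j‖ ^ 2 := by
  classical
  -- The kernel is real and antisymmetric; the factor `i` makes it Hermitian, so its norm is read
  -- off its eigenvalues.
  set B : Matrix ι ι ℂ := Matrix.of fun j k => Complex.I * csc x j k with hB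
  have hBh : B.IsHermitian := by
    ext j k
    simp only [hB, conjTranspose_apply, of_apply, star_mul', RCLike.star_def, Complex.conj_I,
      Complex.conj_ofReal]
    rw [csc_swap x k j]; push_cast; ring
  have hBn : ‖B‖ ≤ 1 / d := by
    refine l2_opNorm_le_of_eigenvalues hBh (by positivity) fun lam v hv0 hv => ?_
    refine hx.abs_eigenvalue_le hd lam v hv0 fun j => ?_
    have h1 := congrFun hv j
    simp only [mulVec, dotProduct, hB, of_apply, Pi.smul_apply, smul_eq_mul] at h1
    simp only [mul_assoc, ← Finset.mul_sum] at h1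
    linear_combination (-Complex.I) * h1 + (∑ k, (csc x j k : ℂ) * v k) * Complex.I_sq
  have h1 : ∑ j, ∑ k, (csc x j k : ℂ) * (conj (a j) * a k) =
      -Complex.I * inner ℂ (WithLp.toLp 2 a) (WithLp.toLp 2 (B *ᵥ a)) := by
    simp only [PiLp.inner_apply, mulVec, dotProduct, hB, of_apply, Finset.mul_sum]
    refine Finset.sum_congr rfl fun j _ => ?_
    simp only [RCLike.inner_apply, Finset.mul_sum, Finset.sum_mul]
    refine Finset.sum_congr rfl fun k _ => ?_
    linear_combination ((csc x j k : ℂ) * (conj (a j) * a k)) * Complex.I_sq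
  rw [h1, norm_mul, norm_neg, Complex.norm_I, one_mul]
  calc _ ≤ ‖WithLp.toLp 2 a‖ * ‖WithLp.toLp 2 (B *ᵥ a)‖ := norm_inner_le_norm _ _
    _ ≤ ‖WithLp.toLp 2 a‖ * (‖B‖ * ‖WithLp.toLp 2 a‖) := by
        gcongr
        exact Matrix.l2_opNorm_mulVec B (WithLp.toLp 2 a)
    _ ≤ ‖WithLp.toLp 2 a‖ * (1 / d * ‖WithLp.toLp 2 a‖) := by gcongr
    _ = 1 / d * ‖WithLp.toLp 2 a‖ ^ 2 := by ring
    _ = _ := by rw [EuclideanSpace.norm_sq_eq]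

/-! ### Exponential sums weighted by a function of bounded variation -/

/-- `e(t) = exp (2 π i t)`. -/
noncomputable def ec (t : ℝ) : ℂ := Complex.exp ((2 * Real.pi * t : ℝ) * Complex.I)

theorem norm_ec (t : ℝ) : ‖ec t‖ = 1 := Complex.norm_exp_ofReal_mul_I _

theorem ec_add (s t : ℝ) : ec (s + t) = ec s * ec t := by
  rw [ec, ec, ec, ← Complex.exp_add]; congr 1; push_cast; ring

theorem ec_zero : ec 0 = 1 := by simp [ec]

theorem conj_ec (t : ℝ) : (starRingEnd ℂ) (ec t) = ec (-t) := by
  rw [ec, ec, ← Complex.exp_conj, map_mul, Complex.conj_ofReal, Complex.conj_I]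
  congr 1; push_cast; ring

theorem ec_int (p : ℤ) : ec p = 1 := by
  rw [ec, Complex.exp_eq_one_iff]; exact ⟨p, by push_cast; ring⟩

theorem ec_eq_one_iff {t : ℝ} : ec t = 1 ↔ ∃ p : ℤ, t = p := by
  refine ⟨fun h => ?_, fun ⟨p, hp⟩ => hp ▸ ec_int p⟩
  obtain ⟨p, hp⟩ := Complex.exp_eq_one_iff.1 h
  refine ⟨p, ?_⟩
  have h1 := congrArg Complex.im hp
  simp at h1
  have := Real.pi_pos
  nlinarith

theorem ec_nat_mul (k : ℕ) (t : ℝ) : ec (k * t) = ec t ^ k := by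
  rw [ec, ec, ← Complex.exp_nat_mul]; congr 1; push_cast; ring

theorem ec_half_sub (y : ℝ) :
    ec (y / 2) - ec (-(y / 2)) = 2 * Complex.I * (Real.sin (Real.pi * y) : ℂ) := by
  have h1 : ∀ s : ℝ, ec s = (Real.cos (2 * Real.pi * s) : ℂ) +
      (Real.sin (2 * Real.pi * s) : ℂ) * Complex.I := by
    intro s; rw [ec, Complex.exp_mul_I]; push_cast; ring
  rw [h1, h1, show 2 * Real.pi * (y / 2) = Real.pi * y by ring,
    show 2 * Real.pi * -(y / 2) = -(Real.pi * y) by ring, Real.cos_neg, Real.sin_neg]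
  push_cast; ring

theorem sum_range_sub_mul_eq (H : ℕ → ℝ) (E : ℕ → ℂ) (Q : ℕ) :
    ∑ k ∈ Finset.range (Q + 1), ((H (k + 1) - H k : ℝ) : ℂ) * E k =
      H (Q + 1) * E Q - H 0 * E 0 - ∑ k ∈ Finset.range Q, (H (k + 1) : ℂ) * (E (k + 1) - E k) := by
  induction Q with
  | zero => simp; ring
  | succ Q ih =>
    rw [Finset.sum_range_succ, ih, Finset.sum_range_succ]
    push_cast; ring

/-- With `y = x l - x j`, `ec (k y)` is the difference of `ec ((k ± 1/2) y)` divided by `2i sin πy`.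
Summation by parts moves the difference onto `H`, without boundary terms because `H` vanishes at
both ends. -/
theorem TorusSeparated.sum_mul_ec {ι : Type*} {x : ι → ℝ} {d : ℝ} (hd : 0 < d)
    (hx : TorusSeparated x d) {H : ℕ → ℝ} {Q : ℕ} (h0 : H 0 = 0) (hQ : H (Q + 1) = 0)
    {j l : ι} (hjl : j ≠ l) :
    ∑ k ∈ Finset.range Q, (H (k + 1) : ℂ) * ec (k * (x l - x j)) =
      ∑ k ∈ Finset.range (Q + 1), ((H (k + 1) - H k : ℝ) : ℂ) *
        ((csc x j l : ℂ) * ec ((k - 1 / 2) * (x l - x j)) / (2 * Complex.I)) := by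
  have hs := hx.sin_ne_zero hd hjl
  set y := x l - x j with hy
  have hs' : Real.sin (Real.pi * (x j - x l)) = - Real.sin (Real.pi * y) := by
    rw [← Real.sin_neg]; congr 1; ring
  have hsy : (Real.sin (Real.pi * y) : ℂ) ≠ 0 := by
    rw [hs'] at hs; exact_mod_cast neg_ne_zero.1 hs
  rw [sum_range_sub_mul_eq, h0, hQ]
  simp only [Complex.ofReal_zero, zero_mul, sub_zero, zero_sub]
  rw [← Finset.sum_neg_distrib]
  refine Finset.sum_congr rfl fun k _ => ?_
  have e1 : ec (((k + 1 : ℕ) - 1 / 2) * y) = ec (k * y) * ec (y / 2) := by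
    rw [← ec_add]; congr 1; push_cast; ring
  have e2 : ec ((k - 1 / 2) * y) = ec (k * y) * ec (-(y / 2)) := by
    rw [← ec_add]; congr 1; ring
  have h3 := ec_half_sub y
  rw [e1, e2, csc, hs']
  push_cast at hsy h3 ⊢
  rw [inv_neg]
  have hI := Complex.I_ne_zero
  field_simp
  linear_combination (-(H (k + 1) : ℂ) * ec (k * y)) * h3

open ComplexConjugate in
theorem norm_sum_sq_eq {ι : Type*} [Fintype ι] (b : ι → ℂ) :
    ((‖∑ j, b j‖ ^ 2 : ℝ) : ℂ) = ∑ j, ∑ l, conj (b j) * b l := by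
  push_cast
  rw [← Complex.conj_mul', map_sum, Finset.sum_mul_sum]

open ComplexConjugate in
-- For each `k` the off-diagonal terms form a Hilbert form in the modulated coefficients `a j * ec
-- ((k - 1/2) x j)`, which have the same moduli as `a j`. Its bound `1 / d` does not depend on `k`,
-- so only the variation of `H` enters.
theorem TorusSeparated.abs_weighted_sum_sub_le {ι : Type*} [Fintype ι] {x : ι → ℝ} {d : ℝ}
    (hd : 0 < d) (hx : TorusSeparated x d) {H : ℕ → ℝ} {Q : ℕ} (h0 : H 0 = 0) (hQ : H (Q + 1) = 0)
    (a : ι → ℂ) :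
    |∑ k ∈ Finset.range Q, H (k + 1) * ‖∑ j, a j * ec (k * x j)‖ ^ 2 -
      (∑ k ∈ Finset.range Q, H (k + 1)) * ∑ j, ‖a j‖ ^ 2| ≤
      1 / (2 * d) * (∑ k ∈ Finset.range (Q + 1), |H (k + 1) - H k|) * ∑ j, ‖a j‖ ^ 2 := by
  classical
  have key : ((∑ k ∈ Finset.range Q, H (k + 1) * ‖∑ j, a j * ec (k * x j)‖ ^ 2 -
      (∑ k ∈ Finset.range Q, H (k + 1)) * ∑ j, ‖a j‖ ^ 2 : ℝ) : ℂ) =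
      ∑ k ∈ Finset.range (Q + 1), ((H (k + 1) - H k : ℝ) : ℂ) / (2 * Complex.I) *
        ∑ j, ∑ l, (csc x j l : ℂ) *
          (conj (a j * ec ((k - 1 / 2) * x j)) * (a l * ec ((k - 1 / 2) * x l))) := by
    have hc : ∀ (s : ℝ) (j l : ι), conj (a j * ec (s * x j)) * (a l * ec (s * x l)) =
        conj (a j) * a l * ec (s * (x l - x j)) := by
      intro s j l
      rw [map_mul, conj_ec, show s * (x l - x j) = -(s * x j) + s * x l by ring, ec_add]
      ring
    rw [Complex.ofReal_sub, Complex.ofReal_sum]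
    simp only [Complex.ofReal_mul (H _), norm_sum_sq_eq, hc]
    have e1 : ∑ k ∈ Finset.range Q, (H (k + 1) : ℂ) *
        ∑ j, ∑ l, conj (a j) * a l * ec (k * (x l - x j)) =
        ∑ j, ∑ l, conj (a j) * a l *
          ∑ k ∈ Finset.range Q, (H (k + 1) : ℂ) * ec (k * (x l - x j)) := by
      simp only [Finset.mul_sum]
      rw [Finset.sum_comm]
      refine Finset.sum_congr rfl fun j _ => ?_
      rw [Finset.sum_comm]
      refine Finset.sum_congr rfl fun l _ => Finset.sum_congr rfl fun k _ => by ring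
    have e2 : ∑ k ∈ Finset.range (Q + 1), ((H (k + 1) - H k : ℝ) : ℂ) / (2 * Complex.I) *
        ∑ j, ∑ l, (csc x j l : ℂ) * (conj (a j) * a l * ec ((k - 1 / 2) * (x l - x j))) =
        ∑ j, ∑ l, conj (a j) * a l * ∑ k ∈ Finset.range (Q + 1), ((H (k + 1) - H k : ℝ) : ℂ) *
        ((csc x j l : ℂ) * ec ((k - 1 / 2) * (x l - x j)) / (2 * Complex.I)) := by
      simp only [Finset.mul_sum]
      rw [Finset.sum_comm]
      refine Finset.sum_congr rfl fun j _ => ?_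
      rw [Finset.sum_comm]
      refine Finset.sum_congr rfl fun l _ => Finset.sum_congr rfl fun k _ => by ring
    rw [e1, e2]
    have e3 : ((((∑ k ∈ Finset.range Q, H (k + 1)) * ∑ j, ‖a j‖ ^ 2 : ℝ)) : ℂ) =
        ∑ j, conj (a j) * a j * ∑ k ∈ Finset.range Q, (H (k + 1) : ℂ) := by
      rw [← Finset.sum_mul, mul_comm]
      push_cast
      congr 1
      exact Finset.sum_congr rfl fun j _ => (Complex.conj_mul' _).symm
    rw [e3, ← Finset.sum_sub_distrib]
    refine Finset.sum_congr rfl fun j _ => ?_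
    rw [← Finset.add_sum_erase _ _ (Finset.mem_univ j), ← Finset.add_sum_erase _ (fun l =>
      conj (a j) * a l * ∑ k ∈ Finset.range (Q + 1), ((H (k + 1) - H k : ℝ) : ℂ) *
        ((csc x j l : ℂ) * ec ((k - 1 / 2) * (x l - x j)) / (2 * Complex.I))) (Finset.mem_univ j)]
    simp only [sub_self, mul_zero, ec_zero, mul_one, csc_self, Complex.ofReal_zero,
      zero_div, Finset.sum_const_zero, zero_add, add_sub_cancel_left]
    refine Finset.sum_congr rfl fun l hl => ?_
    rw [hx.sum_mul_ec hd h0 hQ (Finset.ne_of_mem_erase hl).symm]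
  rw [← Real.norm_eq_abs, ← Complex.norm_real, key]
  calc _ ≤ ∑ k ∈ Finset.range (Q + 1), |H (k + 1) - H k| / 2 * (1 / d * ∑ j, ‖a j‖ ^ 2) := by
        refine norm_sum_le_of_le _ fun k _ => ?_
        rw [norm_mul, norm_div, norm_mul, Complex.norm_I, Complex.norm_ofNat, Complex.norm_real,
          Real.norm_eq_abs, mul_one]
        refine mul_le_mul_of_nonneg_left ?_ (by positivity)
        refine (hx.hilbert_inequality hd _).trans (le_of_eq ?_)
        simp [norm_ec]
    _ = _ := by
        rw [← Finset.sum_mul, ← Finset.sum_div]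
        field_simp

/-! ### Grid refinement: from sums of samples to integrals -/

theorem sum_range_mul_eq {α : Type*} [AddCommMonoid α] (w : ℕ → α) (N M : ℕ) :
    ∑ k ∈ Finset.range (M * N), w k =
      ∑ i ∈ Finset.range N, ∑ m ∈ Finset.range M, w (M * i + m) := by
  induction N with
  | zero => simp
  | succ N ih => rw [Nat.mul_succ, Finset.sum_range_add, ih, Finset.sum_range_succ]

/-- The `M` preimages of each point under multiplication by `M` on the circle. Preimages of one
point are `1 / M` apart, whence the assumption `d ≤ 1`. -/
theorem TorusSeparated.replicate {ι : Type*} {x : ι → ℝ} {d : ℝ} (hd1 : d ≤ 1)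
    (hx : TorusSeparated x d) {M : ℕ} (hM : 0 < M) :
    TorusSeparated (fun p : ι × Fin M => (x p.1 + (p.2 : ℕ)) / M) (d / M) := by
  rintro ⟨j, m⟩ ⟨l, m'⟩ hne p
  have hM' : (0 : ℝ) < M := by exact_mod_cast hM
  have e : (x j + (m : ℕ)) / M - (x l + (m' : ℕ)) / M + p =
      (x j - x l + ((m : ℤ) - (m' : ℤ) + p * M : ℤ)) / M := by
    push_cast; field_simp; ring
  simp only
  rw [e, abs_div, abs_of_pos hM']
  gcongr
  rcases eq_or_ne j l with rfl | hjl
  · have hmm : (m : ℤ) - (m' : ℤ) + p * M ≠ 0 := by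
      intro h0
      apply hne
      have h1 : (m : ℤ) % M = (m' : ℤ) % M := by
        have : (m : ℤ) = (m' : ℤ) + M * (-p) := by linarith
        rw [this, Int.add_mul_emod_self_left]
      rw [Int.emod_eq_of_lt (by positivity) (by exact_mod_cast m.2),
        Int.emod_eq_of_lt (by positivity) (by exact_mod_cast m'.2)] at h1
      simp only [Prod.mk.injEq, true_and]
      exact Fin.ext (by exact_mod_cast h1)
    rw [sub_self, zero_add, ← Int.cast_abs]
    have : (1 : ℝ) ≤ |(m : ℤ) - (m' : ℤ) + p * M| := by exact_mod_cast Int.one_le_abs hmm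
    linarith
  · exact hx j l hjl _

theorem sum_ec_div_eq_zero {M : ℕ} (hM : 0 < M) {t : ℤ} (ht : ¬ (M : ℤ) ∣ t) :
    ∑ m ∈ Finset.range M, ec (t * m / M) = 0 := by
  have hM' : (M : ℝ) ≠ 0 := by exact_mod_cast hM.ne'
  have h1 : ∀ m : ℕ, ec (t * m / M) = ec (t / M) ^ m := fun m => by
    rw [← ec_nat_mul]; congr 1; ring
  simp only [h1]
  have hne : ec ((t : ℝ) / M) ≠ 1 := by
    intro h
    obtain ⟨p, hp⟩ := ec_eq_one_iff.1 h
    apply ht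
    refine ⟨p, ?_⟩
    rw [div_eq_iff hM'] at hp
    have : (t : ℝ) = ((M * p : ℤ) : ℝ) := by rw [hp]; push_cast; ring
    exact_mod_cast this
  rw [geom_sum_eq hne, ← ec_nat_mul, mul_div_cancel₀ _ hM', ec_int]
  simp

/-- Sampling on a grid that is `2 q + 1` times finer, with the locations replicated accordingly. -/
theorem TorusSeparated.abs_refined_sum_sub_le {ι : Type*} [Fintype ι] {x : ι → ℝ} {d : ℝ}
    (hd : 0 < d) (hd1 : d ≤ 1) (hx : TorusSeparated x d) (n q : ℕ) {H : ℕ → ℝ} (h0 : H 0 = 0)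
    (hQ : H ((2 * q + 1) * (2 * n + 1) + 1) = 0) (a : ι → ℂ) :
    |(2 * q + 1 : ℝ) * ∑ i ∈ Finset.range (2 * n + 1), H ((2 * q + 1) * i + q + 1) *
        ‖∑ j, a j * ec ((i - n) * x j)‖ ^ 2 -
      (∑ k ∈ Finset.range ((2 * q + 1) * (2 * n + 1)), H (k + 1)) * ∑ j, ‖a j‖ ^ 2| ≤
      (2 * q + 1) / (2 * d) * (∑ k ∈ Finset.range ((2 * q + 1) * (2 * n + 1) + 1),
        |H (k + 1) - H k|) * ∑ j, ‖a j‖ ^ 2 := by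
  classical
  set M : ℕ := 2 * q + 1 with hMdef
  have hM : 0 < M := by omega
  have hMr : (0 : ℝ) < M := by exact_mod_cast hM
  have hMr' : (M : ℝ) = 2 * q + 1 := by rw [hMdef]; push_cast; ring
  -- The fine index of the frequency zero.
  set c : ℤ := M * n + q with hc
  have hW := (hx.replicate hd1 hM).abs_weighted_sum_sub_le (by positivity) h0 hQ
    (fun p => a p.1 * ec (-c * ((x p.1 + (p.2 : ℕ)) / M)))
  have e1 : ∑ p : ι × Fin M, ‖a p.1 * ec (-c * ((x p.1 + (p.2 : ℕ)) / M))‖ ^ 2 =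
      M * ∑ j, ‖a j‖ ^ 2 := by
    simp [norm_ec, Fintype.sum_prod_type, Finset.mul_sum]
  have e2 : ∀ k : ℕ, ∑ p : ι × Fin M, a p.1 * ec (-c * ((x p.1 + (p.2 : ℕ)) / M)) *
      ec (k * ((x p.1 + (p.2 : ℕ)) / M)) =
      (∑ j, a j * ec (((k : ℤ) - c : ℤ) * x j / M)) *
        ∑ m ∈ Finset.range M, ec (((k : ℤ) - c : ℤ) * m / M) := by
    intro k
    rw [Fintype.sum_prod_type, Finset.sum_mul]
    refine Finset.sum_congr rfl fun j _ => ?_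
    rw [Finset.mul_sum, ← Fin.sum_univ_eq_sum_range
      (fun m => a j * ec (((k : ℤ) - c : ℤ) * x j / M) * ec (((k : ℤ) - c : ℤ) * m / M))]
    refine Finset.sum_congr rfl fun m _ => ?_
    rw [mul_assoc, mul_assoc, ← ec_add, ← ec_add]
    congr 2
    push_cast
    ring
  have e3 : ∑ k ∈ Finset.range (M * (2 * n + 1)), H (k + 1) *
      ‖∑ p : ι × Fin M, a p.1 * ec (-c * ((x p.1 + (p.2 : ℕ)) / M)) *
      ec (k * ((x p.1 + (p.2 : ℕ)) / M))‖ ^ 2 =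
      ∑ i ∈ Finset.range (2 * n + 1), (M : ℝ) ^ 2 * (H (M * i + q + 1) *
        ‖∑ j, a j * ec ((i - n) * x j)‖ ^ 2) := by
    rw [sum_range_mul_eq]
    refine Finset.sum_congr rfl fun i _ => ?_
    -- Summing over the replicas is a root-of-unity filter: in each block of `M` fine indices only
    -- the middle one, a coarse frequency, survives. Taking `M` odd gives every block a middle.
    rw [Finset.sum_eq_single q]
    · rw [e2]
      have ht : ((M * i + q : ℕ) : ℤ) - c = M * ((i : ℤ) - n) := by rw [hc]; push_cast; ring
      have h1 : ∑ m ∈ Finset.range M, ec ((((M * i + q : ℕ) : ℤ) - c : ℤ) * m / M) = M := by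
        rw [Finset.sum_congr rfl (g := fun _ => (1 : ℂ))]
        · simp
        · intro m _
          rw [ht, show ((M * ((i : ℤ) - n) : ℤ) : ℝ) * m / M = ((((i : ℤ) - n) * m : ℤ) : ℝ) by
            push_cast; field_simp]
          exact ec_int _
      have h2 : ∀ j, ec ((((M * i + q : ℕ) : ℤ) - c : ℤ) * x j / M) = ec ((i - n) * x j) := by
        intro j
        rw [ht]; congr 1; push_cast; field_simp
      rw [h1]
      simp only [h2]
      rw [norm_mul, Complex.norm_natCast]
      ring
    · intro m hm hmq
      rw [e2, sum_ec_div_eq_zero hM, mul_zero, norm_zero]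
      · ring
      · have hm' := Finset.mem_range.1 hm
        have : ((M * i + m : ℕ) : ℤ) - c = M * ((i : ℤ) - n) + ((m : ℤ) - q) := by
          rw [hc]; push_cast; ring
        rw [this, Int.dvd_add_right (Dvd.intro _ rfl)]
        intro hdvd
        have hz := Int.eq_zero_of_abs_lt_dvd hdvd (by rw [abs_lt]; constructor <;> omega)
        omega
    · intro hq; exact absurd (Finset.mem_range.2 (by omega)) hq
  rw [e3, e1, ← Finset.mul_sum] at hW
  rw [← hMr']
  have hfin : ∀ A B V S : ℝ, |(M : ℝ) ^ 2 * A - B * (M * S)| ≤ 1 / (2 * (d / M)) * V * (M * S) →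
      |(M : ℝ) * A - B * S| ≤ M / (2 * d) * V * S := by
    intro A B V S h
    have h1 : (M : ℝ) ^ 2 * A - B * (M * S) = M * (M * A - B * S) := by ring
    have h2 : 1 / (2 * (d / M)) * V * (M * S) = M * (M / (2 * d) * V * S) := by field_simp
    rw [h1, h2, abs_mul, abs_of_pos hMr] at h
    exact le_of_mul_le_mul_left h hMr
  exact hfin _ _ _ _ hW

theorem exists_midpoint_sum_close {h : ℝ → ℝ} (hh : Continuous h) (a L : ℝ) {ε : ℝ} (hε : 0 < ε) :
    ∃ δ > 0, ∀ (K : ℕ) (w : ℝ), 0 < w → w < δ → K * w = L →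
      |∑ k ∈ Finset.range K, w * h (a + (k + 1 / 2) * w) - ∫ x in a..(a + L), h x| ≤ ε * L := by
  have hu := (isCompact_Icc (a := a) (b := a + L)).uniformContinuousOn_of_continuous
    hh.continuousOn
  obtain ⟨δ, hδ, hδ'⟩ := Metric.uniformContinuousOn_iff.1 hu ε hε
  refine ⟨δ, hδ, fun K w hw hwδ hKw => ?_⟩
  have h1 : ∫ x in a..(a + L), h x =
      ∑ k ∈ Finset.range K, ∫ x in (a + k * w)..(a + (k + 1 : ℕ) * w), h x := by
    rw [intervalIntegral.sum_integral_adjacent_intervals (a := fun k : ℕ => a + k * w)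
      fun k _ => hh.intervalIntegrable _ _, hKw]
    simp
  rw [h1, ← Finset.sum_sub_distrib, ← Real.norm_eq_abs]
  calc _ ≤ ∑ k ∈ Finset.range K, ε * w := by
        refine norm_sum_le_of_le _ fun k hk => ?_
        have hkK : (k + 1 : ℝ) ≤ K := by exact_mod_cast Finset.mem_range.1 hk
        have hk0 : (0 : ℝ) ≤ k := by positivity
        have hle : (k + 1) * w ≤ L := by rw [← hKw]; gcongr
        have hk0w : 0 ≤ k * w := by positivity
        have e1 : w * h (a + (k + 1 / 2) * w) =
            ∫ x in (a + k * w)..(a + (k + 1 : ℕ) * w), h (a + (k + 1 / 2) * w) := by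
          rw [intervalIntegral.integral_const, smul_eq_mul]; push_cast; ring
        rw [e1, ← intervalIntegral.integral_sub (by simp) (hh.intervalIntegrable _ _)]
        refine (intervalIntegral.norm_integral_le_of_norm_le_const (C := ε) fun x hx => ?_).trans ?_
        · rw [Set.uIoc_of_le (by push_cast; nlinarith)] at hx
          obtain ⟨hx1, hx2⟩ := hx
          push_cast at hx2
          rw [← dist_eq_norm]
          refine (hδ' _ ⟨by nlinarith, by nlinarith⟩ _ ⟨by nlinarith, by nlinarith⟩ ?_).le
          rw [Real.dist_eq, abs_lt]
          constructor <;> nlinarith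
        · push_cast
          rw [show a + (k + 1) * w - (a + k * w) = w by ring, abs_of_pos hw]
    _ = _ := by rw [Finset.sum_const, Finset.card_range, nsmul_eq_mul, ← hKw]; ring

theorem sum_abs_sub_le_of_eVariationOn_le {f : ℝ → ℝ} {V : ℝ} (hV : 0 ≤ V)
    (hf : eVariationOn f Set.univ ≤ ENNReal.ofReal V) {u : ℕ → ℝ} (hu : Monotone u) (K : ℕ) :
    ∑ k ∈ Finset.range K, |f (u (k + 1)) - f (u k)| ≤ V := by
  have h1 := (eVariationOn.sum_le (f := f) (s := Set.univ) (n := K) hu fun _ => Set.mem_univ _).trans hf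
  simp only [edist_dist, Real.dist_eq] at h1
  rw [← ENNReal.ofReal_sum_of_nonneg fun _ _ => abs_nonneg _] at h1
  exact (ENNReal.ofReal_le_ofReal_iff hV).1 h1

/-- The large sieve bounds for a sampled weight of bounded variation. -/
theorem TorusSeparated.abs_sampled_sum_sub_le {ι : Type*} [Fintype ι] {x : ι → ℝ} {d : ℝ}
    (hd : 0 < d) (hd1 : d ≤ 1) (hx : TorusSeparated x d) {n : ℕ} {T : ℝ} (hT : 0 < T) {h : ℝ → ℝ}
    (hh : Continuous h) {V : ℝ} (hV : 0 ≤ V)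
    (hVar : eVariationOn ((band n T).indicator h) Set.univ ≤ ENNReal.ofReal V) (a : ι → ℂ) :
    |∑ i ∈ Finset.range (2 * n + 1), h ((i - n) / T) * ‖∑ j, a j * ec ((i - n) * x j)‖ ^ 2 -
      T * (∫ f in band n T, h f) * ∑ j, ‖a j‖ ^ 2| ≤ V / (2 * d) * ∑ j, ‖a j‖ ^ 2 := by
  set S := ∑ j, ‖a j‖ ^ 2 with hS
  have hS0 : 0 ≤ S := by positivity
  refine le_of_forall_pos_le_add fun ε hε => ?_
  -- `L` is the length of the band. The tolerance is chosen so that the quadrature error, multiplied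
  -- by `T * S`, stays below `ε`; `S + 1` avoids dividing by zero.
  set L : ℝ := (2 * n + 1) / T with hL
  have hL0 : 0 < L := by positivity
  obtain ⟨δ, hδ, hclose⟩ := exists_midpoint_sum_close hh (-((2 * n + 1 : ℝ) / (2 * T))) L
    (ε := ε / (T * L * (S + 1))) (by positivity)
  obtain ⟨q, hq⟩ := exists_nat_gt (1 / (δ * T))
  set M : ℝ := 2 * q + 1 with hM
  have hM0 : 0 < M := by positivity
  -- The indices `1, ..., M (2n + 1)` run through the midpoints of the cells of width `1 / (M T)`
  -- that tile the band. The two further indices `0` and `M (2n + 1) + 1` fall outside, so `H`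
  -- vanishes there and its variation sees the jumps at the ends of the band.
  set u : ℕ → ℝ := fun k => ((k : ℝ) - 1 - (M * n + q)) / (M * T) with hu
  have humono : Monotone u := fun k l hkl => by
    have : (k : ℝ) ≤ l := by exact_mod_cast hkl
    simp only [hu]; gcongr
  set H : ℕ → ℝ := fun k => (band n T).indicator h (u k) with hH
  have hband : ∀ t : ℝ, (t / (M * T) ∈ band n T ↔ |t| ≤ M * (2 * n + 1) / 2) := by
    intro t
    rw [band, Set.mem_Icc, ← abs_le, abs_div, abs_of_pos (by positivity : 0 < M * T),
      div_le_div_iff₀ (by positivity) (by positivity)]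
    constructor
    · intro hle
      have : T * |t| ≤ T * (M * (2 * n + 1) / 2) := by nlinarith
      exact le_of_mul_le_mul_left this hT
    · intro hle
      have := mul_le_mul_of_nonneg_left hle hT.le
      nlinarith
  have h0 : H 0 = 0 := by
    refine Set.indicator_of_notMem ?_ _
    simp only [hu]
    rw [hband, not_le, Nat.cast_zero, abs_of_nonpos (by nlinarith [hM0, (n.cast_nonneg : (0:ℝ) ≤ n)])]
    rw [hM]; nlinarith
  have hQ : H ((2 * q + 1) * (2 * n + 1) + 1) = 0 := by
    refine Set.indicator_of_notMem ?_ _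
    simp only [hu]
    rw [hband, not_le]
    refine lt_of_lt_of_le ?_ (le_abs_self _)
    rw [hM]; push_cast; nlinarith
  have hin : ∀ k < (2 * q + 1) * (2 * n + 1), H (k + 1) = h (u (k + 1)) := by
    intro k hk
    refine Set.indicator_of_mem ?_ _
    simp only [hu]
    rw [hband, abs_le]
    have hk' : (k : ℝ) + 1 ≤ (2 * q + 1) * (2 * n + 1) := by exact_mod_cast hk
    have hk0 : (0 : ℝ) ≤ k := by positivity
    rw [hM]; push_cast
    constructor <;> nlinarith
  have hmain := hx.abs_refined_sum_sub_le hd hd1 n q h0 hQ a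
  have e1 : ∑ i ∈ Finset.range (2 * n + 1), H ((2 * q + 1) * i + q + 1) *
        ‖∑ j, a j * ec ((i - n) * x j)‖ ^ 2 =
      ∑ i ∈ Finset.range (2 * n + 1), h ((i - n) / T) * ‖∑ j, a j * ec ((i - n) * x j)‖ ^ 2 := by
    refine Finset.sum_congr rfl fun i hi => ?_
    have hi' := Finset.mem_range.1 hi
    rw [hin _ (by nlinarith)]
    congr 2
    simp only [hu]
    rw [div_eq_div_iff (by positivity) (by positivity), hM]
    push_cast; ring
  have e2 := hclose ((2 * q + 1) * (2 * n + 1)) (1 / (M * T)) (by positivity)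
    (by
      rw [div_lt_iff₀ (by positivity)] at hq ⊢
      nlinarith [mul_pos hδ hT])
    (by push_cast; rw [hL, ← hM]; field_simp)
  have e3 : ∑ k ∈ Finset.range ((2 * q + 1) * (2 * n + 1)), 1 / (M * T) *
      h (-((2 * n + 1 : ℝ) / (2 * T)) + (k + 1 / 2) * (1 / (M * T))) =
      1 / (M * T) * ∑ k ∈ Finset.range ((2 * q + 1) * (2 * n + 1)), H (k + 1) := by
    rw [Finset.mul_sum]
    refine Finset.sum_congr rfl fun k hk => ?_
    rw [hin k (Finset.mem_range.1 hk)]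
    congr 2
    simp only [hu]
    field_simp
    rw [hM]; push_cast; ring
  have e4 : ∫ x in (-((2 * n + 1 : ℝ) / (2 * T)))..(-((2 * n + 1 : ℝ) / (2 * T)) + L), h x =
      ∫ f in band n T, h f := by
    rw [band, MeasureTheory.integral_Icc_eq_integral_Ioc, intervalIntegral.integral_of_le (by linarith)]
    congr 3
    rw [hL]; field_simp; ring
  rw [e3, e4] at e2
  rw [e1, ← hM, ← hS] at hmain
  have hvar := sum_abs_sub_le_of_eVariationOn_le hV hVar humono ((2 * q + 1) * (2 * n + 1) + 1)
  change ∑ k ∈ Finset.range ((2 * q + 1) * (2 * n + 1) + 1), |H (k + 1) - H k| ≤ V at hvar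
  generalize ∑ k ∈ Finset.range ((2 * q + 1) * (2 * n + 1) + 1), |H (k + 1) - H k| = V' at *
  generalize ∑ k ∈ Finset.range ((2 * q + 1) * (2 * n + 1)), H (k + 1) = Hs at *
  generalize ∑ i ∈ Finset.range (2 * n + 1), h ((i - n) / T) *
    ‖∑ j, a j * ec ((i - n) * x j)‖ ^ 2 = A at *
  generalize ∫ f in band n T, h f = E at *
  have f1 : |A - 1 / M * Hs * S| ≤ V / (2 * d) * S := by
    have : M * A - Hs * S = M * (A - 1 / M * Hs * S) := by field_simp
    rw [this, abs_mul, abs_of_pos hM0] at hmain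
    refine le_of_mul_le_mul_left (hmain.trans ?_) hM0
    calc M / (2 * d) * V' * S ≤ M / (2 * d) * V * S := by gcongr
      _ = _ := by ring
  have f2 : |1 / M * Hs * S - T * E * S| ≤ ε := by
    have : 1 / M * Hs * S - T * E * S = (T * S) * (1 / (M * T) * Hs - E) := by field_simp
    rw [this, abs_mul, abs_of_nonneg (by positivity)]
    calc _ ≤ T * S * (ε / (T * L * (S + 1)) * L) := by gcongr
      _ = ε * (S / (S + 1)) := by field_simp
      _ ≤ ε * 1 := by
        gcongr
        rw [div_le_one (by positivity)]; linarith
      _ = ε := mul_one _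
  calc |A - T * E * S| ≤ |A - 1 / M * Hs * S| + |1 / M * Hs * S - T * E * S| := abs_sub_le _ _ _
    _ ≤ _ := add_le_add f1 f2

/-! ### Matching the eigenvalues of a perturbed diagonal matrix -/

theorem exists_perm_of_prod_X_sub_C_eq {r : ℕ} {f g : Fin r → ℂ}
    (h : ∏ k, (Polynomial.X - Polynomial.C (f k)) = ∏ k, (Polynomial.X - Polynomial.C (g k))) :
    ∃ π : Equiv.Perm (Fin r), ∀ k, g (π k) = f k := by
  classical
  have hroots : ∀ u : Fin r → ℂ,
      (∏ k, (Polynomial.X - Polynomial.C (u k))).roots = Finset.univ.val.map u := by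
    intro u
    have := Polynomial.roots_multiset_prod_X_sub_C (Finset.univ.val.map u)
    rwa [Multiset.map_map] at this
  have hm : Finset.univ.val.map f = Finset.univ.val.map g := by
    rw [← hroots f, ← hroots g, h]
  have hcard : ∀ c, Fintype.card {a // f a = c} = Fintype.card {a // g a = c} := by
    intro c
    have := congrArg (Multiset.count c) hm
    rw [Multiset.count_map, Multiset.count_map] at this
    rw [Fintype.card_subtype, Fintype.card_subtype]
    simpa [Finset.card, Finset.filter_val, eq_comm] using this
  exact ⟨Equiv.ofFiberEquiv fun c => Fintype.equivOfCardEq (hcard c), fun k =>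
    Equiv.ofFiberEquiv_map _ k⟩

theorem exists_charpoly_eq_prod {r : ℕ} (A : Matrix (Fin r) (Fin r) ℂ) :
    ∃ μ : Fin r → ℂ, A.charpoly = ∏ k, (Polynomial.X - Polynomial.C (μ k)) := by
  have hs := IsAlgClosed.splits A.charpoly
  have hcard : A.charpoly.roots.toList.length = r := by
    rw [Multiset.length_toList, ← hs.natDegree_eq_card_roots, Matrix.charpoly_natDegree_eq_dim,
      Fintype.card_fin]
  refine ⟨fun k => A.charpoly.roots.toList.get (k.cast hcard.symm), ?_⟩
  have h1 := Polynomial.prod_multiset_X_sub_C_of_monic_of_roots_card_eq A.charpoly_monic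
    hs.natDegree_eq_card_roots.symm
  conv_lhs => rw [← h1, ← Multiset.coe_toList A.charpoly.roots]
  rw [Multiset.map_coe, Multiset.prod_coe]
  generalize A.charpoly.roots.toList = l at hcard
  subst hcard
  exact (Fin.prod_univ_fun_getElem l fun a => Polynomial.X - Polynomial.C a).symm

open Matrix in
/-- The **Bauer-Fike** theorem for a perturbed diagonal matrix. -/
theorem exists_norm_sub_le_of_isRoot {r : ℕ} {z : Fin r → ℂ} {B : Matrix (Fin r) (Fin r) ℂ} {η : ℝ}
    (hη : ‖B‖ ≤ η) {μ : ℂ} (hμ : (diagonal z + B).charpoly.eval μ = 0) :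
    ∃ j, ‖z j - μ‖ ≤ η := by
  by_contra! hcon
  have hη0 : 0 ≤ η := (norm_nonneg B).trans hη
  rw [Matrix.eval_charpoly, ← Matrix.exists_mulVec_eq_zero_iff] at hμ
  obtain ⟨v, hv0, hv⟩ := hμ
  have h1 : ∀ j, (B *ᵥ v) j = -((z j - μ) * v j) := by
    intro j
    have := congrFun hv j
    rw [Matrix.scalar_apply, Matrix.sub_mulVec, Matrix.add_mulVec, Pi.sub_apply, Pi.add_apply,
      Matrix.mulVec_diagonal, Matrix.mulVec_diagonal, Pi.zero_apply] at this
    linear_combination -this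
  have h2 := (Matrix.l2_opNorm_mulVec B (WithLp.toLp 2 v)).trans
    (mul_le_mul_of_nonneg_right hη (norm_nonneg _))
  have h3 : ‖WithLp.toLp 2 (B *ᵥ v)‖ ^ 2 ≤ (η * ‖WithLp.toLp 2 v‖) ^ 2 :=
    pow_le_pow_left₀ (norm_nonneg _) h2 2
  rw [mul_pow, EuclideanSpace.norm_sq_eq, EuclideanSpace.norm_sq_eq, Finset.mul_sum] at h3
  simp only [h1, norm_neg, norm_mul, mul_pow] at h3
  refine absurd h3 (not_le.2 ?_)
  obtain ⟨i, hi⟩ := Function.ne_iff.1 hv0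
  have hi' : 0 < ‖v i‖ := norm_pos_iff.2 hi
  refine Finset.sum_lt_sum (fun j _ => ?_) ⟨i, Finset.mem_univ i, ?_⟩
  · have := hcon j; gcongr
  · have := hcon i; gcongr

theorem dist_le_of_walk {V : Type*} {G : SimpleGraph V} {z : V → ℂ} {c : ℝ}
    (h : ∀ j k, G.Adj j k → ‖z j - z k‖ ≤ c) {j k : V} (p : G.Walk j k) :
    ‖z j - z k‖ ≤ p.length * c := by
  induction p with
  | nil => simp
  | @cons u v w huv p ih =>
    rw [SimpleGraph.Walk.length_cons]
    push_cast
    have := norm_sub_le_norm_sub_add_norm_sub (z u) (z v) (z w)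
    linarith [h _ _ huv]

/-- The parameters `t` at which the eigenvalues of `diagonal z + t B` can be listed such that the
`k`-th one is `η`-close to `z (σ k)`. -/
def matchingTimes {r : ℕ} (z : Fin r → ℂ) (B : Matrix (Fin r) (Fin r) ℂ) (η : ℝ)
    (σ : Fin r → Fin r) : Set ℝ :=
  {t | t ∈ Set.Icc (0 : ℝ) 1 ∧ ∃ μ : Fin r → ℂ,
    (Matrix.diagonal z + (t : ℂ) • B).charpoly = ∏ k, (Polynomial.X - Polynomial.C (μ k)) ∧
    ∀ k, ‖z (σ k) - μ k‖ ≤ η}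

/-- This replaces continuity of eigenvalues: the admissible pairs `(t, μ)` form a compact set, as
`μ` is confined to a product of closed discs, and its projection to `t` is closed. -/
theorem isClosed_matchingTimes {r : ℕ} (z : Fin r → ℂ) (B : Matrix (Fin r) (Fin r) ℂ) (η : ℝ)
    (σ : Fin r → Fin r) : IsClosed (matchingTimes z B η σ) := by
  have h1 : matchingTimes z B η σ = Prod.fst '' ((Set.Icc (0 : ℝ) 1 ×ˢ
      Set.univ.pi fun k => Metric.closedBall (z (σ k)) η) ∩
      ⋂ x : ℂ, {p : ℝ × (Fin r → ℂ) | (Matrix.scalar (Fin r) x -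
        (Matrix.diagonal z + (p.1 : ℂ) • B)).det = ∏ k, (x - p.2 k)}) := by
    ext t
    have hpoly : ∀ μ : Fin r → ℂ,
        (Matrix.diagonal z + (t : ℂ) • B).charpoly = ∏ k, (Polynomial.X - Polynomial.C (μ k)) ↔
        ∀ x : ℂ, (Matrix.scalar (Fin r) x - (Matrix.diagonal z + (t : ℂ) • B)).det =
          ∏ k, (x - μ k) := by
      intro μ
      constructor
      · intro h x
        rw [← Matrix.eval_charpoly, h, Polynomial.eval_prod]; simp
      · intro h
        refine Polynomial.funext fun x => ?_
        rw [Matrix.eval_charpoly, h, Polynomial.eval_prod]; simp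
    simp only [matchingTimes, Set.mem_ofPred_eq, Set.mem_image, Set.mem_inter_iff, Set.mem_prod,
      Set.mem_iInter, Set.mem_pi, Set.mem_univ, true_imp_iff, mem_closedBall_iff_norm', Prod.exists,
      hpoly]
    constructor
    · rintro ⟨ht, μ, hμ, hd⟩
      exact ⟨t, μ, ⟨⟨ht, hd⟩, hμ⟩, rfl⟩
    · rintro ⟨t, μ, ⟨⟨ht, hd⟩, hμ⟩, rfl⟩
      exact ⟨ht, μ, hμ, hd⟩
  rw [h1]
  refine IsCompact.isClosed (IsCompact.image ?_ continuous_fst)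
  refine ((isCompact_Icc).prod (isCompact_univ_pi fun k => isCompact_closedBall _ _)).inter_right ?_
  refine isClosed_iInter fun x => isClosed_eq ?_ ?_
  · refine Continuous.matrix_det ?_
    fun_prop
  · fun_prop

open Matrix in
-- Group the `z_j` into clusters. As `t` runs from `0` to `1` no eigenvalue of `diagonal z + t B`
-- can pass from one cluster to another, so each cluster keeps as many eigenvalues as it has
-- members. Any matching within clusters then costs at most a cluster diameter plus `η`.
theorem exists_perm_norm_sub_le {r : ℕ} {z : Fin r → ℂ} {B : Matrix (Fin r) (Fin r) ℂ} {η : ℝ}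
    (hη : ‖B‖ ≤ η) {μ : Fin r → ℂ}
    (hμ : (diagonal z + B).charpoly = ∏ k, (Polynomial.X - Polynomial.C (μ k))) :
    ∃ π : Equiv.Perm (Fin r), ∀ k, ‖z k - μ (π k)‖ ≤ 2 * r * η := by
  classical
  have hη0 : 0 ≤ η := (norm_nonneg B).trans hη
  set G : SimpleGraph (Fin r) := SimpleGraph.fromRel fun j k => ‖z j - z k‖ ≤ 2 * η with hG
  have hadj : ∀ j k, ‖z j - z k‖ ≤ 2 * η → G.Reachable j k := by
    intro j k h
    rcases eq_or_ne j k with rfl | hne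
    · exact SimpleGraph.Reachable.refl _
    · exact SimpleGraph.Adj.reachable ((SimpleGraph.fromRel_adj _ _ _).2 ⟨hne, Or.inl h⟩)
  -- An assignment is good if it hits each cluster the right number of times, that is, agrees with a
  -- permutation up to clusters.
  let good : (Fin r → Fin r) → Prop := fun σ => ∃ π : Equiv.Perm (Fin r), ∀ k, G.Reachable (σ k) (π k)
  have hmeet : ∀ σ σ' t, t ∈ matchingTimes z B η σ → t ∈ matchingTimes z B η σ' →
      good σ → good σ' := by
    rintro σ σ' t ⟨_, ν, hν, hd⟩ ⟨_, ν', hν', hd'⟩ ⟨π, hπ⟩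
    obtain ⟨ρ, hρ⟩ := exists_perm_of_prod_X_sub_C_eq (hν'.symm.trans hν)
    refine ⟨ρ.trans π, fun k => SimpleGraph.Reachable.trans (hadj _ _ ?_) (hπ (ρ k))⟩
    have h1 := hd' k
    have h2 := hd (ρ k)
    rw [hρ] at h2
    calc _ ≤ ‖z (σ' k) - ν' k‖ + ‖ν' k - z (σ (ρ k))‖ := norm_sub_le_norm_sub_add_norm_sub _ _ _
      _ ≤ η + η := add_le_add h1 (by rwa [norm_sub_rev])
      _ = 2 * η := by ring
  set S : Set ℝ := ⋃ σ ∈ {σ | good σ}, matchingTimes z B η σ with hS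
  set S' : Set ℝ := ⋃ σ ∈ {σ | ¬ good σ}, matchingTimes z B η σ with hS'
  have hclosed : ∀ P : Set (Fin r → Fin r), IsClosed (⋃ σ ∈ P, matchingTimes z B η σ) := fun P =>
    (Set.toFinite P).isClosed_biUnion fun σ _ => isClosed_matchingTimes z B η σ
  have hcover : Set.Icc (0 : ℝ) 1 ⊆ S ∪ S' := by
    intro t ht
    obtain ⟨ν, hν⟩ := exists_charpoly_eq_prod (diagonal z + (t : ℂ) • B)
    have hB : ‖(t : ℂ) • B‖ ≤ η := by
      rw [norm_smul, Complex.norm_real, Real.norm_eq_abs, abs_of_nonneg ht.1]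
      nlinarith [ht.1, ht.2, norm_nonneg B]
    have hex : ∀ k, ∃ j, ‖z j - ν k‖ ≤ η := fun k => by
      refine exists_norm_sub_le_of_isRoot hB ?_
      rw [hν, Polynomial.eval_prod]
      exact Finset.prod_eq_zero (Finset.mem_univ k) (by simp)
    choose σ hσ using hex
    have hmem : t ∈ matchingTimes z B η σ := ⟨ht, ν, hν, hσ⟩
    by_cases hg : good σ
    · exact Or.inl (Set.mem_biUnion (show σ ∈ {σ | good σ} from hg) hmem)
    · exact Or.inr (Set.mem_biUnion (show σ ∈ {σ | ¬ good σ} from hg) hmem)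
  have hzero : (0 : ℝ) ∈ S := by
    refine Set.mem_biUnion (show id ∈ {σ | good σ} from
      ⟨Equiv.refl _, fun k => SimpleGraph.Reachable.refl _⟩) ⟨by simp, z, ?_, fun k => by simpa⟩
    simp [Matrix.charpoly_diagonal]
  have hone : (1 : ℝ) ∈ S := by
    by_contra hnot
    have h1 : (1 : ℝ) ∈ S' := (hcover (by simp)).resolve_left hnot
    -- Two closed sets covering `[0, 1]` and both meeting it share a time `t`. There a good and a
    -- bad assignment list the same eigenvalues, so their values lie within `2η` of each other,
    -- hence in the same clusters: a contradiction.
    obtain ⟨t, _, htS, htS'⟩ := isPreconnected_closed_iff.1 (isPreconnected_Icc (a := (0 : ℝ)) (b := 1))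
      S S' (hclosed _) (hclosed _) hcover ⟨0, by simp, hzero⟩ ⟨1, by simp, h1⟩
    obtain ⟨σ, hσ, ht⟩ := Set.mem_iUnion₂.1 htS
    obtain ⟨σ', hσ', ht'⟩ := Set.mem_iUnion₂.1 htS'
    exact hσ' (hmeet σ σ' t ht ht' hσ)
  obtain ⟨σ, ⟨π, hπ⟩, _, ν, hν, hd⟩ := Set.mem_iUnion₂.1 hone
  rw [Complex.ofReal_one, one_smul] at hν
  obtain ⟨ρ, hρ⟩ := exists_perm_of_prod_X_sub_C_eq (hν.symm.trans hμ)
  refine ⟨π.symm.trans ρ, fun k => ?_⟩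
  rw [Equiv.trans_apply, hρ]
  set i := π.symm k with hi
  have hk : k = π i := by simp [hi]
  obtain ⟨p, hp⟩ := (hπ i).exists_isPath
  have hlen : p.length + 1 ≤ r := by simpa using hp.length_lt
  have hlen' : (p.length : ℝ) + 1 ≤ r := by exact_mod_cast hlen
  have h1 := dist_le_of_walk (z := z) (c := 2 * η) (fun j k hjk => by
    rcases ((SimpleGraph.fromRel_adj _ _ _).1 hjk).2 with h | h
    · exact h
    · rwa [norm_sub_rev]) p
  rw [hk]
  have h2 := norm_sub_le_norm_sub_add_norm_sub (z (π i)) (z (σ i)) (ν i)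
  rw [norm_sub_rev (z (π i)) (z (σ i))] at h2
  -- A path has at most `r - 1` steps of length `2η`, and the eigenvalue adds `η`: in all at most
  -- `(2r - 1) η`.
  nlinarith [hd i, mul_le_mul_of_nonneg_right hlen' hη0]

/-! ### From eigenvalues to locations -/

/-- Normalising `w` to the circle at most doubles its distance to `1`; on the circle the chord is `2
|sin(φ/2)| ≥ 2 |φ| / π` by Jordan's inequality. -/
theorem abs_arg_le (w : ℂ) : |Complex.arg w| ≤ Real.pi * ‖w - 1‖ := by
  rcases eq_or_ne w 0 with rfl | hw
  · simp [Real.pi_pos.le]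
  have hpi := Real.pi_pos
  set φ := Complex.arg w with hφ
  set u : ℂ := Complex.exp (φ * Complex.I) with hu
  have hwu : (‖w‖ : ℂ) * u = w := Complex.norm_mul_exp_arg_mul_I w
  have hun : ‖u‖ = 1 := Complex.norm_exp_ofReal_mul_I _
  have h1 : ‖u - w‖ ≤ ‖w - 1‖ := by
    have : u - w = ((1 - ‖w‖ : ℝ) : ℂ) * u := by push_cast; linear_combination hwu
    rw [this, norm_mul, hun, mul_one, Complex.norm_real, Real.norm_eq_abs, norm_sub_rev]
    simpa using abs_norm_sub_norm_le (1 : ℂ) w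
  have h2 : ‖u - 1‖ ≤ 2 * ‖w - 1‖ := by
    have := norm_sub_le_norm_sub_add_norm_sub u w 1
    linarith
  have h3 : ‖u - 1‖ = 2 * |Real.sin (φ / 2)| := by
    have := Complex.norm_exp_I_mul_ofReal_sub_one φ
    rw [hu, mul_comm, this, norm_mul, Real.norm_eq_abs, Real.norm_eq_abs]; simp
  have h4 : 2 / Real.pi * |φ / 2| ≤ |Real.sin (φ / 2)| := by
    refine Real.mul_abs_le_abs_sin ?_
    have := Complex.abs_arg_le_pi w
    rw [abs_div, abs_two]; linarith
  rw [abs_div, abs_two] at h4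
  have h5 : 2 / Real.pi * (|φ| / 2) ≤ ‖w - 1‖ := by linarith
  have h6 : 2 / Real.pi * (|φ| / 2) = |φ| / Real.pi := by ring
  rw [h6, div_le_iff₀ hpi] at h5
  linarith

theorem bddBelow_torusDist (T x y : ℝ) : BddBelow (Set.range fun p : ℤ => |x - y + p * T|) :=
  ⟨0, by rintro _ ⟨p, rfl⟩; positivity⟩

theorem torusDist_nonneg (T x y : ℝ) : 0 ≤ torusDist T x y :=
  Real.iInf_nonneg fun _ => abs_nonneg _

theorem torusDist_le (T x y : ℝ) (p : ℤ) : torusDist T x y ≤ |x - y + p * T| :=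
  ciInf_le (bddBelow_torusDist T x y) p

theorem torusDist_le_half {T : ℝ} (hT : 0 < T) (x y : ℝ) : torusDist T x y ≤ T / 2 := by
  refine (torusDist_le T x y (-round ((x - y) / T))).trans ?_
  have h := abs_sub_round ((x - y) / T)
  have e : x - y + (-round ((x - y) / T) : ℤ) * T = ((x - y) / T - round ((x - y) / T)) * T := by
    push_cast; field_simp; ring
  rw [e, abs_mul, abs_of_pos hT]
  nlinarith

theorem torusDist_arg_le {T : ℝ} (hT : 0 < T) (t : ℝ) (μ : ℂ) :
    torusDist T t (-(T / (2 * Real.pi)) * Complex.arg μ) ≤ T / 2 * ‖ec (-t / T) - μ‖ := by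
  have hpi := Real.pi_pos
  -- A zero eigenvalue has no argument, but the claimed bound is then `T / 2`, the diameter of the
  -- torus.
  rcases eq_or_ne μ 0 with rfl | hμ
  · rw [sub_zero, norm_ec, mul_one]
    exact torusDist_le_half hT _ _
  set w : ℂ := μ * ec (t / T) with hw
  have hne : ec (t / T) ≠ 0 := Complex.exp_ne_zero _
  have hnw : ‖w - 1‖ = ‖ec (-t / T) - μ‖ := by
    have h1 : ec (t / T) * ec (-t / T) = 1 := by
      rw [← ec_add, ← ec_zero]; congr 1; ring
    have : w - 1 = -((ec (-t / T) - μ) * ec (t / T)) := by rw [hw]; linear_combination h1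
    rw [this, norm_neg, norm_mul, norm_ec, mul_one]
  have hang : ((Complex.arg w : ℝ) : Real.Angle) =
      ((Complex.arg μ + 2 * Real.pi * (t / T) : ℝ) : Real.Angle) := by
    rw [hw, Complex.arg_mul_coe_angle hμ hne, Real.Angle.coe_add]
    congr 1
    rw [ec, Complex.arg_exp_mul_I, Real.Angle.coe_toIocMod]
  obtain ⟨p, hp⟩ := Real.Angle.angle_eq_iff_two_pi_dvd_sub.1 hang
  refine (torusDist_le T _ _ p).trans ?_
  have e : t - -(T / (2 * Real.pi)) * Complex.arg μ + p * T =
      T / (2 * Real.pi) * Complex.arg w := by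
    have : Complex.arg w = Complex.arg μ + 2 * Real.pi * (t / T) + 2 * Real.pi * p := by linarith
    rw [this]; field_simp; ring
  rw [e, abs_mul, abs_of_pos (by positivity), ← hnw]
  calc T / (2 * Real.pi) * |w.arg| ≤ T / (2 * Real.pi) * (Real.pi * ‖w - 1‖) := by
        gcongr; exact abs_arg_le w
    _ = _ := by field_simp

theorem matchDist_le {r : ℕ} {T c : ℝ} (hc : 0 ≤ c) {τ τ' : Fin r → ℝ}
    (π : Equiv.Perm (Fin r)) (h : ∀ k, torusDist T (τ k) (τ' (π k)) ≤ c) :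
    matchDist T τ' τ ≤ c :=
  (ciInf_le (Set.finite_range _).bddBelow π).trans (Real.iSup_le h hc)

/-! ### The point spread function -/

theorem continuous_ghat {g : ℝ → ℝ} (hg : MeasureTheory.Integrable g) : Continuous (ghat g) :=
  VectorFourier.fourierIntegral_continuous Real.continuous_fourierChar
    (by exact continuous_inner) hg.ofReal

theorem norm_ghat_neg (g : ℝ → ℝ) (f : ℝ) : ‖ghat g (-f)‖ = ‖ghat g f‖ := by
  have h : ghat g (-f) = (starRingEnd ℂ) (ghat g f) := by
    rw [ghat, ghat, Real.fourier_real_eq_integral_exp_smul,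
      Real.fourier_real_eq_integral_exp_smul, ← integral_conj]
    refine MeasureTheory.integral_congr_ae (Filter.Eventually.of_forall fun t => ?_)
    simp only [smul_eq_mul, map_mul, Complex.conj_ofReal, ← Complex.exp_conj, Complex.conj_I]
    congr 2
    push_cast; ring
  rw [h, RCLike.norm_conj]

theorem bandEnergy_pos {n : ℕ} {T : ℝ} {g : ℝ → ℝ} (hT : 0 < T) (hg : MeasureTheory.Integrable g)
    (h0 : ghat g 0 ≠ 0) : 0 < bandEnergy n T g := by
  have hN : 0 < (2 * n + 1 : ℝ) / (2 * T) := by positivity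
  rw [bandEnergy, band, MeasureTheory.integral_Icc_eq_integral_Ioc,
    ← intervalIntegral.integral_of_le (by linarith)]
  refine intervalIntegral.integral_pos (by linarith)
    ((continuous_ghat hg).norm.pow 2).continuousOn (fun _ _ => by positivity)
    ⟨0, ⟨by linarith, hN.le⟩, ?_⟩
  have := norm_pos_iff.2 h0
  positivity

/-- The truncated density is nonzero at `0` and zero outside the band. This rules out `0 / 0 = 0` in
`sepRatio` when two locations coincide. -/
theorem eVariationOn_band_ne_zero {n : ℕ} {T : ℝ} {g : ℝ → ℝ} (hT : 0 < T)
    (h0 : ghat g 0 ≠ 0) :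
    eVariationOn ((band n T).indicator fun f => ‖ghat g f‖ ^ 2) Set.univ ≠ 0 := by
  intro h
  have hN : 0 < (2 * n + 1 : ℝ) / (2 * T) := by positivity
  have h1 := eVariationOn.edist_le ((band n T).indicator fun f => ‖ghat g f‖ ^ 2)
    (Set.mem_univ (0 : ℝ)) (Set.mem_univ ((2 * n + 1 : ℝ) / (2 * T) + 1))
  rw [h, nonpos_iff_eq_zero, edist_eq_zero, Set.indicator_of_mem, Set.indicator_of_notMem] at h1
  · exact h0 (norm_eq_zero.1 (pow_eq_zero_iff two_ne_zero |>.1 h1))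
  · rw [band, Set.mem_Icc]; intro hc; linarith [hc.2]
  · exact ⟨by linarith, hN.le⟩

theorem matGV_mulVec {r : ℕ} (n : ℕ) (T : ℝ) (g : ℝ → ℝ) (τ : Fin r → ℝ) (a : Fin r → ℂ)
    (m : Fin (2 * n + 1)) :
    ((matG n T g * matV n T τ).mulVec a) m =
      ghat g (freq n T m) * ∑ j, a j * ec (((m : ℕ) - n : ℝ) * (-τ j / T)) := by
  rw [matG, ← Matrix.mulVec_mulVec, Matrix.mulVec_diagonal]
  congr 1
  simp only [matV, Matrix.mulVec, dotProduct, Matrix.of_apply]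
  refine Finset.sum_congr rfl fun j _ => ?_
  rw [mul_comm, ec]
  congr 2
  rw [freq]; push_cast; ring

theorem norm_matGV_mulVec_sq {r : ℕ} (n : ℕ) (T : ℝ) (g : ℝ → ℝ) (τ : Fin r → ℝ) (a : Fin r → ℂ) :
    ‖WithLp.toLp 2 ((matG n T g * matV n T τ).mulVec a)‖ ^ 2 =
      ∑ i ∈ Finset.range (2 * n + 1), ‖ghat g ((i - n) / T)‖ ^ 2 *
        ‖∑ j, a j * ec ((i - n) * (-τ j / T))‖ ^ 2 := by
  rw [EuclideanSpace.norm_sq_eq, ← Fin.sum_univ_eq_sum_range (fun i =>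
    ‖ghat g (((i : ℝ) - n) / T)‖ ^ 2 * ‖∑ j, a j * ec (((i : ℝ) - n) * (-τ j / T))‖ ^ 2)]
  refine Finset.sum_congr rfl fun m _ => ?_
  simp only [matGV_mulVec, norm_mul, mul_pow, freq]

/-- The frame bounds of `G V` for at least two locations. -/
theorem frame_bounds {r : ℕ} (hr : 2 ≤ r) {n : ℕ} {T : ℝ} {g : ℝ → ℝ} {τ : Fin r → ℝ} {θ : ℝ}
    (hT : 0 < T) (hg : MeasureTheory.Integrable g) (h0 : ghat g 0 ≠ 0)
    (hs : sepRatio n T g τ ≤ ENNReal.ofReal θ) (a : Fin r → ℂ) :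
    |‖WithLp.toLp 2 ((matG n T g * matV n T τ).mulVec a)‖ ^ 2 -
      T * bandEnergy n T g * ‖WithLp.toLp 2 a‖ ^ 2| ≤
      T * bandEnergy n T g * (sepRatio n T g τ).toReal * ‖WithLp.toLp 2 a‖ ^ 2 := by
  have hE := bandEnergy_pos (n := n) hT hg h0
  have hV0 := eVariationOn_band_ne_zero (n := n) hT h0
  have hfin : sepRatio n T g τ ≠ ⊤ := ne_top_of_le_ne_top ENNReal.ofReal_ne_top hs
  have hle : ∀ j k, j ≠ k → minSep T τ ≤ ENNReal.ofReal (torusDist T (τ j) (τ k)) :=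
    fun j k hjk => (iInf_le _ j).trans ((iInf_le _ k).trans (iInf_le _ hjk))
  have h01 : (⟨0, by omega⟩ : Fin r) ≠ ⟨1, by omega⟩ := by simp
  have hmt : minSep T τ ≠ ⊤ := ne_top_of_le_ne_top ENNReal.ofReal_ne_top (hle _ _ h01)
  rw [sepRatio, flatness] at hfin
  rw [sepRatio, flatness]
  set W := eVariationOn ((band n T).indicator fun f => ‖ghat g f‖ ^ 2) Set.univ with hW
  set E := bandEnergy n T g with hEdef
  have hE0 : ENNReal.ofReal E ≠ 0 := by simpa using hE
  -- Finiteness of the ratio forces distinct locations and, just below, finite variation.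
  have hm0 : minSep T τ ≠ 0 := by
    intro hm
    apply hfin
    rw [hm, mul_zero]
    exact ENNReal.div_zero (ENNReal.div_ne_zero.2 ⟨hV0, ENNReal.ofReal_ne_top⟩)
  have hVt : W ≠ ⊤ := by
    intro hV
    apply hfin
    rw [hV, ENNReal.top_div_of_ne_top ENNReal.ofReal_ne_top]
    exact ENNReal.top_div_of_ne_top (ENNReal.mul_ne_top (by simp) hmt)
  set m := (minSep T τ).toReal with hm
  have hmpos : 0 < m := ENNReal.toReal_pos hm0 hmt
  have hmle : ∀ j k, j ≠ k → m ≤ torusDist T (τ j) (τ k) := fun j k hjk =>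
    (ENNReal.toReal_mono ENNReal.ofReal_ne_top (hle j k hjk)).trans
      (le_of_eq (ENNReal.toReal_ofReal (torusDist_nonneg _ _ _)))
  have hd1 : m / T ≤ 1 := by
    rw [div_le_one hT]
    have := (hmle _ _ h01).trans (torusDist_le_half hT _ _)
    linarith
  have hsep : TorusSeparated (fun j => -τ j / T) (m / T) := by
    intro j k hjk p
    have h1 := (hmle j k hjk).trans (torusDist_le T _ _ (-p))
    have e : -τ j / T - -τ k / T + p = -((τ j - τ k + ((-p : ℤ) : ℝ) * T) / T) := by
      push_cast; field_simp; ring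
    rw [e, abs_neg, abs_div, abs_of_pos hT]
    gcongr
  have key := hsep.abs_sampled_sum_sub_le (by positivity) hd1 hT (n := n)
    (h := fun f => ‖ghat g f‖ ^ 2) ((continuous_ghat hg).norm.pow 2) (V := W.toReal)
    ENNReal.toReal_nonneg (by rw [ENNReal.ofReal_toReal hVt]) a
  rw [norm_matGV_mulVec_sq, EuclideanSpace.norm_sq_eq]
  refine key.trans (le_of_eq ?_)
  rw [ENNReal.toReal_div, ENNReal.toReal_div, ENNReal.toReal_mul, ENNReal.toReal_ofReal hE.le,
    ← hm, ENNReal.toReal_ofNat]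
  change _ = T * E * _ * ∑ j, ‖a j‖ ^ 2
  field_simp

/-! ### Perturbation of the ESPRIT matrix -/

theorem le_of_sq_le_sq₀ {a b : ℝ} (h : a ^ 2 ≤ b ^ 2) (hb : 0 ≤ b) : a ≤ b :=
  (le_abs_self a).trans (abs_le_of_sq_le_sq h hb)

/-- The Euclidean norm of a coordinate vector. -/
noncomputable abbrev l2norm {ι : Type*} [Fintype ι] (v : ι → ℂ) : ℝ := ‖WithLp.toLp 2 v‖

section Vectors

variable {ι κ : Type*} [Fintype ι] [Fintype κ]

theorem l2norm_sq (v : ι → ℂ) : l2norm v ^ 2 = ∑ i, ‖v i‖ ^ 2 := EuclideanSpace.norm_sq_eq _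

theorem l2norm_add_le (v w : ι → ℂ) : l2norm (v + w) ≤ l2norm v + l2norm w := norm_add_le _ _

theorem l2norm_mulVec_le [DecidableEq κ] (A : Matrix ι κ ℂ) (x : κ → ℂ) :
    l2norm (A.mulVec x) ≤ ‖A‖ * l2norm x :=
  Matrix.l2_opNorm_mulVec A (WithLp.toLp 2 x)

theorem opNorm_le_of_l2norm [DecidableEq κ] {A : Matrix ι κ ℂ} {c : ℝ} (hc : 0 ≤ c)
    (h : ∀ x, l2norm (A.mulVec x) ≤ c * l2norm x) : ‖A‖ ≤ c := by
  rw [Matrix.l2_opNorm_def]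
  exact ContinuousLinearMap.opNorm_le_bound _ hc fun x => h x.ofLp

theorem ofReal_l2norm_sq (v : ι → ℂ) : ((l2norm v ^ 2 : ℝ) : ℂ) = star v ⬝ᵥ v := by
  rw [l2norm_sq, dotProduct]
  push_cast
  exact Finset.sum_congr rfl fun i _ => (Complex.conj_mul' _).symm

open Matrix in
theorem ofReal_l2norm_mulVec_sq (A : Matrix ι κ ℂ) (x : κ → ℂ) :
    ((l2norm (A *ᵥ x) ^ 2 : ℝ) : ℂ) = star x ⬝ᵥ ((Aᴴ * A) *ᵥ x) := by
  rw [ofReal_l2norm_sq, star_mulVec, ← dotProduct_mulVec, mulVec_mulVec]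

open Matrix in
theorem l2norm_mulVec_of_conjTranspose_mul_self [DecidableEq κ] {A : Matrix ι κ ℂ} (h : Aᴴ * A = 1)
    (x : κ → ℂ) : l2norm (A *ᵥ x) = l2norm x := by
  have h1 := ofReal_l2norm_mulVec_sq A x
  rw [h, one_mulVec, ← ofReal_l2norm_sq] at h1
  exact (pow_left_inj₀ (norm_nonneg _) (norm_nonneg _) two_ne_zero).1 (by exact_mod_cast h1)

open Matrix in
theorem opNorm_le_one_of_conjTranspose_mul_self [DecidableEq κ] {A : Matrix ι κ ℂ}
    (h : Aᴴ * A = 1) : ‖A‖ ≤ 1 :=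
  opNorm_le_of_l2norm zero_le_one fun x => by
    rw [l2norm_mulVec_of_conjTranspose_mul_self h, one_mul]

open Matrix in
theorem exists_inverse_of_l2norm_le [DecidableEq κ] {A : Matrix κ κ ℂ} {c : ℝ} (hc : 0 < c)
    (h : ∀ x, c * l2norm x ≤ l2norm (A *ᵥ x)) :
    ∃ B : Matrix κ κ ℂ, A * B = 1 ∧ B * A = 1 ∧ ‖B‖ ≤ c⁻¹ := by
  have hdet : A.det ≠ 0 := by
    intro h0
    obtain ⟨v, hv0, hv⟩ := Matrix.exists_mulVec_eq_zero_iff.2 h0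
    have h1 := h v
    rw [hv] at h1
    have h2 : l2norm v ≤ 0 := by
      have h3 : l2norm (0 : κ → ℂ) = 0 := by simp [l2norm]
      rw [h3] at h1
      by_contra hcon
      rw [not_le] at hcon
      nlinarith
    apply hv0
    have := norm_le_zero_iff.1 h2
    exact (WithLp.toLp_eq_zero 2).1 this
  have hu : IsUnit A.det := isUnit_iff_ne_zero.2 hdet
  refine ⟨A⁻¹, A.mul_nonsing_inv hu, A.nonsing_inv_mul hu,
    opNorm_le_of_l2norm (by positivity) fun x => ?_⟩
  have := h (A⁻¹ *ᵥ x)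
  rw [mulVec_mulVec, A.mul_nonsing_inv hu, one_mulVec] at this
  rw [inv_mul_eq_div, le_div_iff₀ hc]
  linarith

end Vectors

/-! ### Pseudo-inverses, row deletion and the perturbed ESPRIT matrix -/

open Matrix in
theorem pinv_mul_self_of_l2norm_le {m k : ℕ} {A : Matrix (Fin m) (Fin k) ℂ} {c : ℝ} (hc : 0 < c)
    (h : ∀ x, c * l2norm x ≤ l2norm (A *ᵥ x)) : pinv A * A = 1 := by
  have h1 : A * (pinv A * A - 1) = 0 := by
    rw [Matrix.mul_sub, ← Matrix.mul_assoc, (pinv_spec A).mul_mul_self, Matrix.mul_one, sub_self]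
  have h2 : ∀ x, (pinv A * A - 1) *ᵥ x = 0 := by
    intro x
    have h3 := h ((pinv A * A - 1) *ᵥ x)
    rw [mulVec_mulVec, h1, zero_mulVec] at h3
    have h4 : l2norm (0 : Fin m → ℂ) = 0 := by simp [l2norm]
    rw [h4] at h3
    have h5 : l2norm ((pinv A * A - 1) *ᵥ x) ≤ 0 := by
      by_contra hcon
      rw [not_le] at hcon
      nlinarith
    exact (WithLp.toLp_eq_zero 2).1 (norm_le_zero_iff.1 h5)
  rw [← sub_eq_zero]
  exact Matrix.ext_of_mulVec_single fun j => by rw [h2, zero_mulVec]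

open Matrix in
-- `A A†` is an orthogonal projection, so `c ‖A† x‖ ≤ ‖A A† x‖ ≤ ‖x‖`.
theorem norm_pinv_le {m k : ℕ} {A : Matrix (Fin m) (Fin k) ℂ} {c : ℝ} (hc : 0 < c)
    (h : ∀ x, c * l2norm x ≤ l2norm (A *ᵥ x)) : ‖pinv A‖ ≤ c⁻¹ := by
  have hproj : ‖A * pinv A‖ ≤ 1 := by
    have h1 : (A * pinv A)ᴴ * (A * pinv A) = A * pinv A := by
      rw [(pinv_spec A).isHermitian_left, ← Matrix.mul_assoc, (pinv_spec A).mul_mul_self]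
    have h2 := Matrix.l2_opNorm_conjTranspose_mul_self (A * pinv A)
    rw [h1] at h2
    by_contra hcon
    rw [not_le] at hcon
    nlinarith
  refine opNorm_le_of_l2norm (by positivity) fun x => ?_
  have h1 := h (pinv A *ᵥ x)
  rw [mulVec_mulVec] at h1
  have h2 := (l2norm_mulVec_le (A * pinv A) x).trans
    (mul_le_mul_of_nonneg_right hproj (norm_nonneg _))
  rw [inv_mul_eq_div, le_div_iff₀ hc]
  linarith

open Matrix in
theorem proj1_mul_apply {r : ℕ} (n : ℕ) (A : Matrix (Fin (2 * n + 1)) (Fin r) ℂ) (i : Fin (2 * n))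
    (j : Fin r) : (proj1 n * A) i j = A i.castSucc j := by
  simp [proj1, Matrix.mul_apply]

open Matrix in
theorem proj2_mul_apply {r : ℕ} (n : ℕ) (A : Matrix (Fin (2 * n + 1)) (Fin r) ℂ) (i : Fin (2 * n))
    (j : Fin r) : (proj2 n * A) i j = A i.succ j := by
  simp [proj2, Matrix.mul_apply]

open Matrix in
theorem proj1_mulVec (n : ℕ) (v : Fin (2 * n + 1) → ℂ) (i : Fin (2 * n)) :
    (proj1 n *ᵥ v) i = v i.castSucc := by
  simp [proj1, mulVec, dotProduct]

open Matrix in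
theorem proj2_mulVec (n : ℕ) (v : Fin (2 * n + 1) → ℂ) (i : Fin (2 * n)) :
    (proj2 n *ᵥ v) i = v i.succ := by
  simp [proj2, mulVec, dotProduct]

open Matrix in
theorem l2norm_proj1_mulVec_sq (n : ℕ) (v : Fin (2 * n + 1) → ℂ) :
    l2norm (proj1 n *ᵥ v) ^ 2 + ‖v (Fin.last (2 * n))‖ ^ 2 = l2norm v ^ 2 := by
  rw [l2norm_sq, l2norm_sq, Fin.sum_univ_castSucc]
  simp only [proj1_mulVec]

open Matrix in
theorem norm_proj1_le (n : ℕ) : ‖proj1 n‖ ≤ 1 :=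
  opNorm_le_of_l2norm zero_le_one fun v => by
    rw [one_mul]
    refine le_of_sq_le_sq₀ ?_ (norm_nonneg _)
    have := l2norm_proj1_mulVec_sq n v
    nlinarith [sq_nonneg ‖v (Fin.last (2 * n))‖]

open Matrix in
theorem norm_proj2_le (n : ℕ) : ‖proj2 n‖ ≤ 1 :=
  opNorm_le_of_l2norm zero_le_one fun v => by
    rw [one_mul]
    refine le_of_sq_le_sq₀ ?_ (norm_nonneg _)
    rw [l2norm_sq, l2norm_sq, Fin.sum_univ_succ]
    simp only [proj2_mulVec]
    nlinarith [sq_nonneg ‖v 0‖]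

open Matrix in
/-- The component of `U'` along `U` is well conditioned, the remainder is small. -/
theorem alignment {N r : ℕ} {U U' : Matrix (Fin N) (Fin r) ℂ} (hU : OrthonormalCols U)
    (hU' : OrthonormalCols U') :
    ‖Uᴴ * U'‖ ≤ 1 ∧ ‖U' - U * (Uᴴ * U')‖ ≤ subspaceDist U' U ∧
      ∀ x, (1 - subspaceDist U' U ^ 2) * l2norm x ^ 2 ≤ l2norm ((Uᴴ * U') *ᵥ x) ^ 2 := by
  have hU1 := opNorm_le_one_of_conjTranspose_mul_self hU
  have hU1' := opNorm_le_one_of_conjTranspose_mul_self hU'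
  set d := subspaceDist U' U with hd
  have hd0 : 0 ≤ d := norm_nonneg _
  have hE : ‖U' - U * (Uᴴ * U')‖ ≤ d := by
    have e : U' - U * (Uᴴ * U') = (U' * U'ᴴ - U * Uᴴ) * U' := by
      rw [Matrix.sub_mul, Matrix.mul_assoc U', hU', Matrix.mul_one, Matrix.mul_assoc]
    rw [e]
    calc _ ≤ d * ‖U'‖ := Matrix.l2_opNorm_mul _ _
      _ ≤ d * 1 := by gcongr
      _ = d := mul_one d
  refine ⟨?_, hE, fun x => ?_⟩
  · calc _ ≤ ‖Uᴴ‖ * ‖U'‖ := Matrix.l2_opNorm_mul _ _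
      _ ≤ 1 * 1 := by
        rw [Matrix.l2_opNorm_conjTranspose]
        gcongr
      _ = 1 := one_mul 1
  · set E := U' - U * (Uᴴ * U') with hEdef
    -- Pythagoras: `E` is orthogonal to the range of `U`.
    have e1 : (Uᴴ * U')ᴴ * (Uᴴ * U') + Eᴴ * E = 1 := by
      have h1 : Uᴴ * E = 0 := by
        rw [hEdef, Matrix.mul_sub, ← Matrix.mul_assoc Uᴴ U, hU, Matrix.one_mul, sub_self]
      have h2 : Eᴴ * E = U'ᴴ * E := by
        conv_lhs => rw [hEdef, conjTranspose_sub, ← hEdef]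
        rw [Matrix.sub_mul, conjTranspose_mul, Matrix.mul_assoc _ Uᴴ E, h1, Matrix.mul_zero, sub_zero]
      rw [h2, hEdef, Matrix.mul_sub, hU', conjTranspose_mul, conjTranspose_conjTranspose]
      simp only [Matrix.mul_assoc]
      abel
    have e2 : l2norm ((Uᴴ * U') *ᵥ x) ^ 2 + l2norm (E *ᵥ x) ^ 2 = l2norm x ^ 2 := by
      have : ((l2norm ((Uᴴ * U') *ᵥ x) ^ 2 + l2norm (E *ᵥ x) ^ 2 : ℝ) : ℂ) =
          ((l2norm x ^ 2 : ℝ) : ℂ) := by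
        rw [Complex.ofReal_add, ofReal_l2norm_mulVec_sq, ofReal_l2norm_mulVec_sq,
          ← dotProduct_add, ← Matrix.add_mulVec, e1, one_mulVec, ofReal_l2norm_sq]
      exact_mod_cast this
    have e3 : l2norm (E *ᵥ x) ^ 2 ≤ (d * l2norm x) ^ 2 :=
      pow_le_pow_left₀ (norm_nonneg _) ((l2norm_mulVec_le E x).trans (by gcongr)) 2
    nlinarith

open Matrix in
-- The basis `U R` obeys the exact shift relation with `M = Q⁻¹ (diagonal z) Q`, where `Q = P R`.
-- Passing to `U' = U R + E` adds an error `X` linear in `E`, and conjugation by `Q` restores the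
-- diagonal matrix. The final bound is the product of `‖Q‖ ‖Q⁻¹‖ ≤ 2κ`, `‖pinv A‖ ≤ 4 / f` and `(‖K‖
-- + ‖M‖) ‖E‖ ≤ (ϱ + 2κ) dist`.
theorem exists_diagonal_add_charpoly_eq {n r : ℕ} {W U U' : Matrix (Fin (2 * n + 1)) (Fin r) ℂ}
    {K : Matrix (Fin (2 * n)) (Fin (2 * n)) ℂ} {z : Fin r → ℂ} {P P' : Matrix (Fin r) (Fin r) ℂ}
    (hUW : U = W * P) (hP : P' * P = 1) (hz : ∀ k, ‖z k‖ ≤ 1)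
    (hshift : K * (proj2 n * W) = proj1 n * W * diagonal z) (hU : OrthonormalCols U)
    (hU' : OrthonormalCols U') {κ ϱ f : ℝ} (hκ : ‖P‖ * ‖P'‖ ≤ κ) (hK : ‖K‖ ≤ ϱ) (hf0 : 0 < f)
    (hf1 : f ≤ 1)
    (hlow : ∀ x, f ^ 2 / 2 * l2norm x ^ 2 ≤ l2norm ((proj1 n * U) *ᵥ x) ^ 2)
    (hdist : 8 * subspaceDist U' U ^ 2 ≤ f ^ 2) :
    ∃ B : Matrix (Fin r) (Fin r) ℂ,
      ‖B‖ ≤ 2 * κ * (4 / f) * (ϱ + 2 * κ) * subspaceDist U' U ∧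
      (pinv (proj1 n * U') * K * (proj2 n * U')).charpoly = (diagonal z + B).charpoly := by
  obtain ⟨hR1, hE, hRlow⟩ := alignment hU hU'
  set d := subspaceDist U' U with hd
  have hd0 : 0 ≤ d := norm_nonneg _
  set R := Uᴴ * U' with hR
  set E := U' - U * R with hEdef
  have hκ0 : 0 ≤ κ := le_trans (by positivity) hκ
  have hRlow' : ∀ x, 7 / 8 * l2norm x ^ 2 ≤ l2norm (R *ᵥ x) ^ 2 := by
    intro x
    refine le_trans ?_ (hRlow x)
    gcongr
    nlinarith
  obtain ⟨R', hRR', hR'R, hR'n⟩ := exists_inverse_of_l2norm_le (A := R) (c := 1 / 2) (by norm_num)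
    fun x => by
      refine le_of_sq_le_sq₀ ?_ (norm_nonneg _)
      nlinarith [hRlow' x, sq_nonneg (l2norm x)]
  have hPP' : P * P' = 1 := mul_eq_one_comm.1 hP
  set A := proj1 n * U' with hA
  have hAlow : ∀ x, f / 4 * l2norm x ≤ l2norm (A *ᵥ x) := by
    intro x
    have e1 : (proj1 n * U) *ᵥ (R *ᵥ x) = A *ᵥ x + -((proj1 n * E) *ᵥ x) := by
      rw [hA, hEdef, Matrix.mul_sub, Matrix.sub_mulVec, mulVec_mulVec, Matrix.mul_assoc]; abel
    have h1 := l2norm_add_le (A *ᵥ x) (-((proj1 n * E) *ᵥ x))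
    rw [← e1] at h1
    have h2 : l2norm (-((proj1 n * E) *ᵥ x)) ≤ d * l2norm x := by
      have : l2norm (-((proj1 n * E) *ᵥ x)) = l2norm ((proj1 n * E) *ᵥ x) := by
        rw [l2norm, WithLp.toLp_neg, norm_neg]
      rw [this]
      refine (l2norm_mulVec_le _ x).trans ?_
      gcongr
      calc _ ≤ ‖proj1 n‖ * ‖E‖ := Matrix.l2_opNorm_mul _ _
        _ ≤ 1 * d := by gcongr; exact norm_proj1_le n
        _ = d := one_mul d
    -- Numerically `(33/50)² < 7/16 = ½ · 7/8` and `1/8 < (9/25)²`, and the difference `33/50 -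
    -- 9/25` exceeds `1/4`.
    have h3 : (33 / 50 * f * l2norm x) ^ 2 ≤ l2norm ((proj1 n * U) *ᵥ (R *ᵥ x)) ^ 2 := by
      refine le_trans ?_ (hlow (R *ᵥ x))
      have h4 := mul_le_mul_of_nonneg_left (hRlow' x) (by positivity : 0 ≤ f ^ 2 / 2)
      nlinarith [sq_nonneg (f * l2norm x)]
    have h3' := le_of_sq_le_sq₀ h3 (norm_nonneg _)
    have h5 : d ≤ 9 / 25 * f := by
      refine le_of_sq_le_sq₀ ?_ (by positivity)
      nlinarith
    have h6 := mul_le_mul_of_nonneg_right h5 (norm_nonneg (WithLp.toLp 2 x))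
    have h7 : 0 ≤ f * l2norm x := by positivity
    change d * l2norm x ≤ 9 / 25 * f * l2norm x at h6
    linarith
  have hpA := pinv_mul_self_of_l2norm_le (by positivity) hAlow
  have hpn := norm_pinv_le (by positivity) hAlow
  set Q := P * R with hQ
  set Q' := R' * P' with hQ'
  have hQQ' : Q * Q' = 1 := by
    rw [hQ, hQ', Matrix.mul_assoc, ← Matrix.mul_assoc R, hRR', Matrix.one_mul, hPP']
  have hQ'Q : Q' * Q = 1 := mul_eq_one_comm.1 hQQ'
  have hQn : ‖Q‖ * ‖Q'‖ ≤ 2 * κ := by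
    have hR'2 : ‖R'‖ ≤ 2 := by norm_num at hR'n; exact hR'n
    calc ‖Q‖ * ‖Q'‖ ≤ (‖P‖ * ‖R‖) * (‖R'‖ * ‖P'‖) := by
          gcongr
          · exact Matrix.l2_opNorm_mul _ _
          · exact Matrix.l2_opNorm_mul _ _
      _ ≤ (‖P‖ * 1) * (2 * ‖P'‖) := by gcongr
      _ = 2 * (‖P‖ * ‖P'‖) := by ring
      _ ≤ 2 * κ := by gcongr
  set M := Q' * diagonal z * Q with hM
  have hMn : ‖M‖ ≤ 2 * κ := by
    have hD : ‖(diagonal z : Matrix (Fin r) (Fin r) ℂ)‖ ≤ 1 := by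
      rw [Matrix.l2_opNorm_diagonal]
      exact (pi_norm_le_iff_of_nonneg zero_le_one).2 hz
    calc ‖M‖ ≤ (‖Q'‖ * ‖(diagonal z : Matrix (Fin r) (Fin r) ℂ)‖) * ‖Q‖ :=
          (norm_mul_le _ _).trans (by gcongr; exact norm_mul_le _ _)
      _ ≤ (‖Q'‖ * 1) * ‖Q‖ := by gcongr
      _ = ‖Q‖ * ‖Q'‖ := by ring
      _ ≤ 2 * κ := hQn
  set X := pinv A * (K * (proj2 n * E) - proj1 n * E * M) with hX
  have hU'E : U' = U * R + E := by rw [hEdef]; abel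
  have hW : W = U * P' := by rw [hUW, Matrix.mul_assoc, hPP', Matrix.mul_one]
  have hmain : pinv A * K * (proj2 n * U') = M + X := by
    -- `A M` contains `Π₁ E M` besides `Π₁ U R M`; this excess is subtracted again in the error
    -- term. Then `pinv A * A = 1` isolates `M`.
    have h1 : K * (proj2 n * U') = A * M + (K * (proj2 n * E) - proj1 n * E * M) := by
      have h2 : K * (proj2 n * (U * R)) = proj1 n * (U * R) * M := by
        calc K * (proj2 n * (U * R)) = (K * (proj2 n * W)) * Q := by
              rw [hUW, hQ]; simp only [Matrix.mul_assoc]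
          _ = proj1 n * U * P' * diagonal z * Q := by
              rw [hshift, hW]; simp only [Matrix.mul_assoc]
          _ = proj1 n * U * (R * R') * P' * diagonal z * Q := by rw [hRR', Matrix.mul_one]
          _ = proj1 n * (U * R) * M := by rw [hM, hQ']; simp only [Matrix.mul_assoc]
      have h3 : A * M = proj1 n * (U * R) * M + proj1 n * E * M := by
        rw [hA, ← Matrix.add_mul, ← Matrix.mul_add, ← hU'E]
      rw [h3]
      conv_lhs => rw [hU'E]
      rw [Matrix.mul_add, Matrix.mul_add, h2]; abel
    rw [Matrix.mul_assoc, h1, Matrix.mul_add, ← Matrix.mul_assoc, hpA, Matrix.one_mul]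
  have hXn : ‖X‖ ≤ 4 / f * ((ϱ + 2 * κ) * d) := by
    have h1 : ‖K * (proj2 n * E) - proj1 n * E * M‖ ≤ (ϱ + 2 * κ) * d := by
      calc _ ≤ ‖K * (proj2 n * E)‖ + ‖proj1 n * E * M‖ := norm_sub_le _ _
        _ ≤ ‖K‖ * (‖proj2 n‖ * ‖E‖) + (‖proj1 n‖ * ‖E‖) * ‖M‖ := by
          refine add_le_add ((Matrix.l2_opNorm_mul _ _).trans ?_) ((Matrix.l2_opNorm_mul _ _).trans ?_)
          · gcongr; exact Matrix.l2_opNorm_mul _ _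
          · gcongr; exact Matrix.l2_opNorm_mul _ _
        _ ≤ ϱ * (1 * d) + (1 * d) * (2 * κ) := by
          gcongr
          · exact (norm_nonneg K).trans hK
          · exact norm_proj2_le n
          · exact norm_proj1_le n
        _ = _ := by ring
    calc ‖X‖ ≤ ‖pinv A‖ * ‖K * (proj2 n * E) - proj1 n * E * M‖ := Matrix.l2_opNorm_mul _ _
      _ ≤ (f / 4)⁻¹ * ((ϱ + 2 * κ) * d) := by gcongr
      _ = _ := by rw [inv_div]
  refine ⟨Q * X * Q', ?_, ?_⟩
  · calc ‖Q * X * Q'‖ ≤ ‖Q‖ * ‖X‖ * ‖Q'‖ :=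
          (norm_mul_le _ _).trans (by gcongr; exact norm_mul_le _ _)
      _ = (‖Q‖ * ‖Q'‖) * ‖X‖ := by ring
      _ ≤ (2 * κ) * (4 / f * ((ϱ + 2 * κ) * d)) := by gcongr
      _ = _ := by ring
  · have h1 : diagonal z + Q * X * Q' = Q * (M + X) * Q' := by
      have h2 : Q * M * Q' = diagonal z := by
        calc Q * M * Q' = (Q * Q') * diagonal z * (Q * Q') := by
              rw [hM]; simp only [Matrix.mul_assoc]
          _ = diagonal z := by rw [hQQ', Matrix.one_mul, Matrix.mul_one]
      rw [Matrix.mul_add, Matrix.add_mul, h2]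
    rw [hmain, h1, Matrix.mul_assoc, Matrix.charpoly_mul_comm, Matrix.mul_assoc, hQ'Q,
      Matrix.mul_one]

/-! ### The measurement matrices -/

theorem matG1_eq (n : ℕ) (T : ℝ) (g : ℝ → ℝ) :
    matG1 n T g = Matrix.diagonal fun m : Fin (2 * n) => ghat g (freq n T m.castSucc) := by
  ext i j
  rw [matG1, Matrix.mul_assoc, proj1_mul_apply, matG, Matrix.diagonal_mul, Matrix.transpose_apply,
    proj1, Matrix.of_apply, Matrix.diagonal_apply]
  simp [Fin.ext_iff]

theorem matG2_eq (n : ℕ) (T : ℝ) (g : ℝ → ℝ) :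
    matG2 n T g = Matrix.diagonal fun m : Fin (2 * n) => ghat g (freq n T m.succ) := by
  ext i j
  rw [matG2, Matrix.mul_assoc, proj2_mul_apply, matG, Matrix.diagonal_mul, Matrix.transpose_apply,
    proj2, Matrix.of_apply, Matrix.diagonal_apply]
  simp [Fin.ext_iff]

theorem matG1_mul_inv {n : ℕ} {T : ℝ} {g : ℝ → ℝ} (h0 : ∀ m, ghat g (freq n T m) ≠ 0) :
    matG1 n T g * (matG2 n T g)⁻¹ = Matrix.diagonal fun m : Fin (2 * n) =>
      ghat g (freq n T m.castSucc) / ghat g (freq n T m.succ) := by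
  have h1 : (matG2 n T g)⁻¹ = Matrix.diagonal fun m : Fin (2 * n) =>
      (ghat g (freq n T m.succ))⁻¹ := by
    refine Matrix.inv_eq_right_inv ?_
    rw [matG2_eq, Matrix.diagonal_mul_diagonal]
    simp [h0]
  rw [h1, matG1_eq, Matrix.diagonal_mul_diagonal]
  simp only [div_eq_mul_inv]

theorem freq_succ_rev (n : ℕ) (T : ℝ) (m : Fin (2 * n)) :
    freq n T m.rev.succ = -freq n T m.castSucc := by
  have h : ((m.rev.succ : Fin (2 * n + 1)) : ℕ) + m.castSucc = 2 * n := by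
    simp [Fin.val_rev]; omega
  have h' : (((m.rev.succ : Fin (2 * n + 1)) : ℕ) : ℝ) + (m.castSucc : ℕ) = 2 * n := by
    exact_mod_cast h
  rw [freq, freq, ← neg_div]
  congr 1
  linarith

theorem freq_castSucc_rev (n : ℕ) (T : ℝ) (m : Fin (2 * n)) :
    freq n T m.rev.castSucc = -freq n T m.succ := by
  rw [← Fin.rev_rev m, freq_succ_rev, Fin.rev_rev, neg_neg]

theorem ratio_le_amplification (n : ℕ) (T : ℝ) (g : ℝ → ℝ) (m : Fin (2 * n)) :
    ‖ghat g (freq n T m.succ)‖ / ‖ghat g (freq n T m.castSucc)‖ ≤ amplification n T g := by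
  refine le_trans (le_of_eq ?_) (le_ciSup (Set.finite_range _).bddAbove m)
  rw [matG1_eq, matG2_eq, Matrix.diagonal_apply_eq, Matrix.diagonal_apply_eq]

/-- As `g` is real, the power spectral density is even and the inverse ratios are bounded alike. -/
theorem inv_ratio_le_amplification (n : ℕ) (T : ℝ) (g : ℝ → ℝ) (m : Fin (2 * n)) :
    ‖ghat g (freq n T m.castSucc)‖ / ‖ghat g (freq n T m.succ)‖ ≤ amplification n T g := by
  have h := ratio_le_amplification n T g m.rev
  rwa [freq_succ_rev, freq_castSucc_rev, norm_ghat_neg, norm_ghat_neg] at h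

theorem amplification_nonneg (n : ℕ) (T : ℝ) (g : ℝ → ℝ) : 0 ≤ amplification n T g :=
  Real.iSup_nonneg fun _ => by positivity

/-- A ratio and its inverse are both bounded by `ϱ_g`, and one of them is at least `1`. -/
theorem one_le_amplification {n : ℕ} {T : ℝ} {g : ℝ → ℝ} (hn : 0 < n)
    (h0 : ∀ m, ghat g (freq n T m) ≠ 0) : 1 ≤ amplification n T g := by
  let m : Fin (2 * n) := ⟨0, by omega⟩
  have h1 := ratio_le_amplification n T g m
  have h2 := inv_ratio_le_amplification n T g m
  have a1 := norm_pos_iff.2 (h0 m.succ)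
  have a2 := norm_pos_iff.2 (h0 m.castSucc)
  rcases le_total ‖ghat g (freq n T m.succ)‖ ‖ghat g (freq n T m.castSucc)‖ with h | h
  · exact ((one_le_div a1).2 h).trans h2
  · exact ((one_le_div a2).2 h).trans h1

theorem norm_matG1_mul_inv_le {n : ℕ} {T : ℝ} {g : ℝ → ℝ} (h0 : ∀ m, ghat g (freq n T m) ≠ 0) :
    ‖matG1 n T g * (matG2 n T g)⁻¹‖ ≤ amplification n T g := by
  rw [matG1_mul_inv h0, Matrix.l2_opNorm_diagonal]
  refine (pi_norm_le_iff_of_nonneg (amplification_nonneg n T g)).2 fun m => ?_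
  rw [norm_div]
  exact inv_ratio_le_amplification n T g m

theorem matV_apply {r : ℕ} (n : ℕ) (T : ℝ) (τ : Fin r → ℝ) (m : Fin (2 * n + 1)) (j : Fin r) :
    matV n T τ m j = ec (((m : ℕ) - n : ℝ) * (-τ j / T)) := by
  rw [matV, Matrix.of_apply, ec]
  congr 1
  rw [freq]; push_cast; ring

/-- The rotational invariance of the measurements. -/
theorem shift_invariance {r : ℕ} {n : ℕ} {T : ℝ} {g : ℝ → ℝ}
    (h0 : ∀ m, ghat g (freq n T m) ≠ 0) (τ : Fin r → ℝ) :
    matG1 n T g * (matG2 n T g)⁻¹ * (proj2 n * (matG n T g * matV n T τ)) =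
      proj1 n * (matG n T g * matV n T τ) * Matrix.diagonal fun k => ec (-τ k / T) := by
  ext i j
  rw [matG1_mul_inv h0, Matrix.diagonal_mul, Matrix.mul_diagonal, proj2_mul_apply, proj1_mul_apply,
    matG, Matrix.diagonal_mul, Matrix.diagonal_mul, matV_apply, matV_apply, ← mul_assoc,
    div_mul_cancel₀ _ (h0 _), mul_assoc, ← ec_add]
  congr 2
  simp only [Fin.val_succ, Fin.val_castSucc]
  push_cast; ring

theorem norm_ghat_le_norm_matG (n : ℕ) (T : ℝ) (g : ℝ → ℝ) (m : Fin (2 * n + 1)) :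
    ‖ghat g (freq n T m)‖ ≤ ‖matG n T g‖ := by
  rw [matG, Matrix.l2_opNorm_diagonal]
  exact norm_le_pi_norm (fun m => ghat g (freq n T m)) m

theorem norm_matGV_apply_sq_le {r : ℕ} (n : ℕ) (T : ℝ) (g : ℝ → ℝ) (τ : Fin r → ℝ) (a : Fin r → ℂ)
    (m : Fin (2 * n + 1)) :
    ‖((matG n T g * matV n T τ).mulVec a) m‖ ^ 2 ≤ ‖matG n T g‖ ^ 2 * r * l2norm a ^ 2 := by
  rw [matGV_mulVec, norm_mul, mul_pow, mul_assoc, l2norm_sq]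
  have h1 : ‖∑ j, a j * ec (((m : ℕ) - n : ℝ) * (-τ j / T))‖ ≤ ∑ j, ‖a j‖ :=
    norm_sum_le_of_le _ fun j _ => by rw [norm_mul, norm_ec, mul_one]
  have h2 : (∑ j, ‖a j‖) ^ 2 ≤ r * ∑ j, ‖a j‖ ^ 2 := by
    simpa using sq_sum_le_card_mul_sum_sq (s := Finset.univ) (f := fun j => ‖a j‖)
  gcongr
  · exact norm_ghat_le_norm_matG n T g m
  · exact (pow_le_pow_left₀ (norm_nonneg _) h1 2).trans h2

/-! ### Conditioning of the signal subspace -/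

open Matrix in
theorem exists_eq_mul_of_range_le {N r s : ℕ} {U : Matrix (Fin N) (Fin r) ℂ}
    {W : Matrix (Fin N) (Fin s) ℂ}
    (h : LinearMap.range U.mulVecLin ≤ LinearMap.range W.mulVecLin) :
    ∃ P : Matrix (Fin s) (Fin r) ℂ, U = W * P := by
  have h1 : ∀ j, ∃ p : Fin s → ℂ, W *ᵥ p = U *ᵥ Pi.single j 1 := fun j =>
    h (LinearMap.mem_range_self U.mulVecLin (Pi.single j 1))
  choose p hp using h1
  refine ⟨Matrix.of fun i j => p j i, ?_⟩
  ext i j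
  have := congrFun (hp j) i
  rw [Matrix.mulVec_single_one] at this
  rw [Matrix.mul_apply]
  exact this.symm

open Matrix in
/-- The change of basis between `U` and `W` is as well conditioned as `W`. -/
theorem norm_mul_norm_le {N r : ℕ} {U W : Matrix (Fin N) (Fin r) ℂ} {P : Matrix (Fin r) (Fin r) ℂ}
    (hU : OrthonormalCols U) (hUW : U = W * P) {α β κ : ℝ} (hα : 0 < α) (hκ : 0 ≤ κ)
    (hβ : β ≤ κ ^ 2 * α) (hlow : ∀ x, α * l2norm x ^ 2 ≤ l2norm (W *ᵥ x) ^ 2)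
    (hupp : ∀ x, l2norm (W *ᵥ x) ^ 2 ≤ β * l2norm x ^ 2) :
    (Uᴴ * W) * P = 1 ∧ ‖P‖ * ‖Uᴴ * W‖ ≤ κ ∧ ∀ x, α * l2norm (P *ᵥ x) ^ 2 ≤ l2norm x ^ 2 := by
  have h1 : (Uᴴ * W) * P = 1 := by rw [Matrix.mul_assoc, ← hUW]; exact hU
  have hP : ∀ x, α * l2norm (P *ᵥ x) ^ 2 ≤ l2norm x ^ 2 := by
    intro x
    have := hlow (P *ᵥ x)
    rwa [mulVec_mulVec, ← hUW, l2norm_mulVec_of_conjTranspose_mul_self hU] at this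
  refine ⟨h1, ?_, hP⟩
  have hs : 0 < Real.sqrt α := Real.sqrt_pos.2 hα
  have hss : Real.sqrt α ^ 2 = α := Real.sq_sqrt hα.le
  have hPn : ‖P‖ ≤ (Real.sqrt α)⁻¹ := by
    refine opNorm_le_of_l2norm (by positivity) fun x => ?_
    rw [inv_mul_eq_div, le_div_iff₀ hs]
    refine le_of_sq_le_sq₀ ?_ (norm_nonneg _)
    rw [mul_pow, hss, mul_comm]
    exact hP x
  -- `Uᴴ W` is the inverse of `P`, so `W = U (Uᴴ W)` and the isometry `U` transfers the upper frame
  -- bound.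
  have hUn : ‖Uᴴ * W‖ ≤ κ * Real.sqrt α := by
    refine opNorm_le_of_l2norm (by positivity) fun x => ?_
    refine le_of_sq_le_sq₀ ?_ (by positivity)
    have h2 : l2norm ((Uᴴ * W) *ᵥ x) = l2norm (W *ᵥ x) := by
      have hW : W = U * (Uᴴ * W) := by
        conv_rhs => rw [hUW, Matrix.mul_assoc, ← hUW, mul_eq_one_comm.1 h1, Matrix.mul_one]
      conv_rhs => rw [hW, ← mulVec_mulVec, l2norm_mulVec_of_conjTranspose_mul_self hU]
    rw [h2, mul_pow, mul_pow, hss]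
    exact (hupp x).trans (by gcongr)
  calc ‖P‖ * ‖Uᴴ * W‖ ≤ (Real.sqrt α)⁻¹ * (κ * Real.sqrt α) := by gcongr
    _ = κ := by field_simp

theorem espritFactor_le_one {r : ℕ} {n : ℕ} {T : ℝ} {g : ℝ → ℝ} {τ : Fin r → ℝ}
    (hT : 0 < T) (hE : 0 < bandEnergy n T g) (hs : (sepRatio n T g τ).toReal ≤ 1) :
    espritFactor n T g τ ≤ 1 := by
  have : 0 ≤ 1 - (sepRatio n T g τ).toReal := by linarith
  rw [espritFactor, sub_le_self_iff]
  positivity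

/-- A single column has condition number one, whatever its norm; no comparison of that norm with `T
E_g` is needed. -/
theorem l2norm_matGV_single {n : ℕ} {T : ℝ} {g : ℝ → ℝ} (τ : Fin 1 → ℝ) (a : Fin 1 → ℂ) :
    l2norm ((matG n T g * matV n T τ).mulVec a) ^ 2 =
      (∑ m, ‖ghat g (freq n T m)‖ ^ 2) * l2norm a ^ 2 := by
  rw [l2norm_sq, l2norm_sq, Finset.sum_mul]
  refine Finset.sum_congr rfl fun m _ => ?_
  simp [matGV_mulVec, norm_ec, mul_pow]

open Matrix in
/-- For a single location, the last coordinate carries at most half of the energy. -/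
theorem half_le_proj1_single {n : ℕ} {T : ℝ} {g : ℝ → ℝ} (hn : 0 < n) (τ : Fin 1 → ℝ)
    (a : Fin 1 → ℂ) :
    1 / 2 * l2norm ((matG n T g * matV n T τ) *ᵥ a) ^ 2 ≤
      l2norm (proj1 n *ᵥ ((matG n T g * matV n T τ) *ᵥ a)) ^ 2 := by
  set v := (matG n T g * matV n T τ) *ᵥ a with hv
  have h1 := l2norm_proj1_mulVec_sq n v
  have hm : ∀ m, ‖v m‖ = ‖ghat g (freq n T m)‖ * ‖a 0‖ := fun m => by
    rw [hv, matGV_mulVec]; simp [norm_ec]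
  have h2 : ‖v (Fin.last (2 * n))‖ = ‖v 0‖ := by
    rw [hm, hm]
    have h3 := freq_succ_rev n T ⟨0, by omega⟩
    have e1 : (Fin.rev ⟨0, by omega⟩ : Fin (2 * n)).succ = Fin.last (2 * n) := by
      ext; simp [Fin.val_rev]; omega
    have e2 : (⟨0, by omega⟩ : Fin (2 * n)).castSucc = 0 := rfl
    rw [e1, e2] at h3
    rw [h3, norm_ghat_neg]
  have h3 : ‖v 0‖ ^ 2 ≤ l2norm (proj1 n *ᵥ v) ^ 2 := by
    rw [l2norm_sq]
    have := Finset.single_le_sum (f := fun i => ‖(proj1 n *ᵥ v) i‖ ^ 2) (fun _ _ => by positivity)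
      (Finset.mem_univ (⟨0, by omega⟩ : Fin (2 * n)))
    rwa [proj1_mulVec] at this
  rw [h2] at h1
  linarith

/-- The signal subspace is well conditioned, also after dropping the last coordinate. -/
theorem exists_change_of_basis {r n : ℕ} {θ T : ℝ} {g : ℝ → ℝ} {τ : Fin r → ℝ}
    {U : Matrix (Fin (2 * n + 1)) (Fin r) ℂ} (hθ0 : 0 ≤ θ) (hθ : θ < 1) (hr : 0 < r) (hn : 0 < n)
    (hT : 0 < T) (hg : MeasureTheory.Integrable g) (h0 : ∀ m, ghat g (freq n T m) ≠ 0)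
    (hs : sepRatio n T g τ ≤ ENNReal.ofReal θ)
    (hrange : LinearMap.range U.mulVecLin = LinearMap.range (matG n T g * matV n T τ).mulVecLin)
    (hU : OrthonormalCols U) :
    espritFactor n T g τ ≤ 1 ∧ ∃ P P' : Matrix (Fin r) (Fin r) ℂ,
      U = matG n T g * matV n T τ * P ∧ P' * P = 1 ∧
      ‖P‖ * ‖P'‖ ≤ Real.sqrt ((1 + θ) / (1 - θ)) ∧
      ∀ x, espritFactor n T g τ / 2 * l2norm x ^ 2 ≤ l2norm ((proj1 n * U).mulVec x) ^ 2 := by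
  have hg0 : ghat g 0 ≠ 0 := by
    have := h0 ⟨n, by omega⟩
    simpa [freq] using this
  have hE := bandEnergy_pos (n := n) hT hg hg0
  have hsθ : (sepRatio n T g τ).toReal ≤ θ := by
    have := ENNReal.toReal_mono ENNReal.ofReal_ne_top hs
    rwa [ENNReal.toReal_ofReal hθ0] at this
  have hs0 : 0 ≤ (sepRatio n T g τ).toReal := ENNReal.toReal_nonneg
  have h1θ : 0 < 1 - θ := by linarith
  have hκ2 : Real.sqrt ((1 + θ) / (1 - θ)) ^ 2 = (1 + θ) / (1 - θ) := Real.sq_sqrt (by positivity)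
  have hF1 := espritFactor_le_one (τ := τ) hT hE (by linarith)
  obtain ⟨P, hP⟩ := exists_eq_mul_of_range_le hrange.le
  refine ⟨hF1, P, U.conjTranspose * (matG n T g * matV n T τ), hP, ?_⟩
  have hUx : ∀ x, l2norm (U.mulVec x) = l2norm x := l2norm_mulVec_of_conjTranspose_mul_self hU
  have hUP : ∀ x, U.mulVec x = (matG n T g * matV n T τ).mulVec (P.mulVec x) := fun x => by
    rw [Matrix.mulVec_mulVec, ← hP]
  -- For `r = 1` the separation is infinite and the frame bounds are not available; the evenness of
  -- `|ĝ|` replaces them. The resulting constant `1/2`, together with `F ≤ 1`, is the reason for `F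
  -- / 2` in the conclusion.
  rcases Nat.lt_or_ge r 2 with hr2 | hr2
  · obtain rfl : r = 1 := by omega
    have hα : 0 < ∑ m, ‖ghat g (freq n T m)‖ ^ 2 :=
      Finset.sum_pos (fun m _ => by have := norm_pos_iff.2 (h0 m); positivity) ⟨0, Finset.mem_univ _⟩
    obtain ⟨k1, k2, _⟩ := norm_mul_norm_le hU hP hα (Real.sqrt_nonneg ((1 + θ) / (1 - θ)))
      (β := ∑ m, ‖ghat g (freq n T m)‖ ^ 2) (by
        rw [hκ2]
        refine le_mul_of_one_le_left hα.le ?_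
        rw [one_le_div h1θ]; linarith)
      (fun x => (l2norm_matGV_single τ x).ge) (fun x => (l2norm_matGV_single τ x).le)
    refine ⟨k1, k2, fun x => ?_⟩
    have h2 := half_le_proj1_single (T := T) (g := g) hn τ (P.mulVec x)
    rw [← hUP, hUx, Matrix.mulVec_mulVec] at h2
    refine le_trans ?_ h2
    gcongr
  · set α := T * bandEnergy n T g * (1 - (sepRatio n T g τ).toReal) with hαdef
    have hTE : 0 < T * bandEnergy n T g := by positivity
    have hα : 0 < α := mul_pos hTE (by linarith)
    have hframe : ∀ x, |l2norm ((matG n T g * matV n T τ).mulVec x) ^ 2 -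
        T * bandEnergy n T g * l2norm x ^ 2| ≤
        T * bandEnergy n T g * (sepRatio n T g τ).toReal * l2norm x ^ 2 := fun x =>
      frame_bounds hr2 hT hg hg0 hs x
    obtain ⟨k1, k2, k3⟩ := norm_mul_norm_le hU hP hα (Real.sqrt_nonneg ((1 + θ) / (1 - θ)))
      (β := T * bandEnergy n T g * (1 + (sepRatio n T g τ).toReal)) (by
        rw [hκ2, hαdef, div_mul_eq_mul_div, le_div_iff₀ h1θ]
        have : (1 + (sepRatio n T g τ).toReal) * (1 - θ) ≤
          (1 + θ) * (1 - (sepRatio n T g τ).toReal) := by nlinarith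
        nlinarith [mul_le_mul_of_nonneg_left this hTE.le])
      (fun x => by have := (abs_le.1 (hframe x)).1; rw [hαdef]; linarith)
      (fun x => by have := (abs_le.1 (hframe x)).2; linarith)
    refine ⟨k1, k2, fun x => ?_⟩
    have h2 := l2norm_proj1_mulVec_sq n (U.mulVec x)
    rw [hUx, Matrix.mulVec_mulVec] at h2
    -- The deleted coordinate is estimated by Cauchy-Schwarz, and `P` by the lower frame bound `α`;
    -- their quotient is the term subtracted in `espritFactor`.
    have h3 := norm_matGV_apply_sq_le n T g τ (P.mulVec x) (Fin.last (2 * n))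
    rw [← hUP] at h3
    have h4 : ‖matG n T g‖ ^ 2 * r * l2norm (P.mulVec x) ^ 2 ≤
        ‖matG n T g‖ ^ 2 * r / α * l2norm x ^ 2 := by
      rw [div_mul_eq_mul_div, le_div_iff₀ hα, mul_assoc]
      have := k3 x
      gcongr
      linarith
    have h5 : espritFactor n T g τ = 1 - ‖matG n T g‖ ^ 2 * r / α := rfl
    have h6 : espritFactor n T g τ * l2norm x ^ 2 ≤ l2norm ((proj1 n * U).mulVec x) ^ 2 := by
      rw [h5]; linarith
    have h7 : 0 ≤ l2norm ((proj1 n * U).mulVec x) ^ 2 := by positivity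
    linarith

end PsfEsprit

/-! ### Assembly of the error bound -/

theorem theorem2 (r : ℕ) (θ : ℝ) (hθ : θ < 1) :
    ∃ C : ℝ, 0 < C ∧
      ∀ (n : ℕ) (T : ℝ) (g : ℝ → ℝ) (L : ℕ) (A : Matrix (Fin r) (Fin L) ℂ)
        (τ τ' : Fin r → ℝ) (U U' : Matrix (Fin (2 * n + 1)) (Fin r) ℂ),
        0 < T →
        MeasureTheory.Integrable g →
        (∀ m, PsfEsprit.ghat g (PsfEsprit.freq n T m) ≠ 0) →
        r + 1 ≤ 2 * n + 1 →
        PsfEsprit.sepRatio n T g τ ≤ ENNReal.ofReal θ →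
        A.rank = r →
        LinearMap.range U.mulVecLin =
          LinearMap.range (PsfEsprit.matG n T g * PsfEsprit.matV n T τ).mulVecLin →
        PsfEsprit.OrthonormalCols U →
        PsfEsprit.OrthonormalCols U' →
        PsfEsprit.subspaceDist U' U <
          1 / (2 * Real.sqrt 2) * Real.sqrt (PsfEsprit.espritFactor n T g τ) →
        PsfEsprit.IsEspritEstimate n T g U' τ' →
        PsfEsprit.matchDist T τ' τ ≤
          C * (T * PsfEsprit.amplification n T g * (PsfEsprit.espritFactor n T g τ)⁻¹ *
            PsfEsprit.subspaceDist U' U) := by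
  -- `θ` may be negative, in which case `ENNReal.ofReal θ` is zero.
  set θ₀ := max θ 0 with hθ₀
  have hθ₀0 : 0 ≤ θ₀ := le_max_right _ _
  have hθ₀1 : θ₀ < 1 := max_lt hθ one_pos
  set κ := Real.sqrt ((1 + θ₀) / (1 - θ₀)) with hκ
  have hκ0 : 0 ≤ κ := Real.sqrt_nonneg _
  -- The first term collects `T / 2` from the argument, `2r` from the matching and `2κ · 4 · (1 +
  -- 2κ)` from the perturbation; the `1` keeps the constant positive when `r = 0`.
  refine ⟨r * (8 * κ * (1 + 2 * κ)) + 1, by positivity, ?_⟩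
  intro n T g L A τ τ' U U' hT hg h0 hrn hs _ hrange hU hU' hdist hest
  set F := PsfEsprit.espritFactor n T g τ with hF
  set d := PsfEsprit.subspaceDist U' U with hd
  set ϱ := PsfEsprit.amplification n T g with hϱ
  have hd0 : 0 ≤ d := norm_nonneg _
  have hϱ0 : 0 ≤ ϱ := PsfEsprit.amplification_nonneg n T g
  -- Otherwise the square root is zero by convention and the distance would be negative.
  have hF0 : 0 < F := by
    by_contra hcon
    rw [Real.sqrt_eq_zero_of_nonpos (not_lt.1 hcon), mul_zero] at hdist
    linarith
  rcases Nat.eq_zero_or_pos r with rfl | hr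
  · exact PsfEsprit.matchDist_le (by positivity) (Equiv.refl _) fun k => k.elim0
  have hn : 0 < n := by omega
  have hϱ1 := PsfEsprit.one_le_amplification hn h0
  obtain ⟨hF1, P, P', hUW, hPP, hcond, hlow⟩ := PsfEsprit.exists_change_of_basis hθ₀0 hθ₀1 hr hn hT
    hg h0 (hs.trans (ENNReal.ofReal_le_ofReal (le_max_left _ _))) hrange hU
  set f := Real.sqrt F with hf
  have hf0 : 0 < f := Real.sqrt_pos.2 hF0
  have hff : f ^ 2 = F := Real.sq_sqrt hF0.le
  have hf1 : f ≤ 1 := Real.sqrt_le_one.2 hF1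
  have h8 : 8 * d ^ 2 ≤ f ^ 2 := by
    have h1 := pow_le_pow_left₀ hd0 hdist.le 2
    have h2 : (1 / (2 * Real.sqrt 2) * f) ^ 2 = f ^ 2 / 8 := by
      rw [mul_pow, div_pow, mul_pow, Real.sq_sqrt (by norm_num)]; ring
    rw [h2] at h1
    linarith
  obtain ⟨μ, hμ, hτ'⟩ := hest
  obtain ⟨B, hB, hchar⟩ := PsfEsprit.exists_diagonal_add_charpoly_eq hUW hPP
    (fun k => (PsfEsprit.norm_ec (-τ k / T)).le) (PsfEsprit.shift_invariance h0 τ) hU hU' hcond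
    (PsfEsprit.norm_matG1_mul_inv_le h0) hf0 hf1 (by rw [hff]; exact hlow) h8
  rw [PsfEsprit.espritMatrix, Matrix.mul_assoc (PsfEsprit.pinv _), hchar] at hμ
  obtain ⟨π, hπ⟩ := PsfEsprit.exists_perm_norm_sub_le hB hμ
  refine PsfEsprit.matchDist_le (by positivity) π fun k => ?_
  rw [hτ' (π k)]
  refine (PsfEsprit.torusDist_arg_le hT _ _).trans ?_
  -- The argument yields the power `F^(-1/2)`; since `F ≤ 1`, the stated `F⁻¹` is weaker.
  have hfF : 4 / f ≤ 4 * F⁻¹ := by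
    rw [div_eq_mul_inv, ← hff]
    gcongr
    nlinarith
  have hsum : ϱ + 2 * κ ≤ (1 + 2 * κ) * ϱ := by nlinarith
  calc T / 2 * ‖PsfEsprit.ec (-τ k / T) - μ (π k)‖
      ≤ T / 2 * (2 * r * (2 * κ * (4 / f) * (ϱ + 2 * κ) * d)) := by gcongr; exact hπ k
    _ ≤ T / 2 * (2 * r * (2 * κ * (4 * F⁻¹) * ((1 + 2 * κ) * ϱ) * d)) := by gcongr
    _ = r * (8 * κ * (1 + 2 * κ)) * (T * ϱ * F⁻¹ * d) := by ring
    _ ≤ (r * (8 * κ * (1 + 2 * κ)) + 1) * (T * ϱ * F⁻¹ * d) := by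
        gcongr; linarith
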